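/- For $x\in\mathbb R^n$ let $(x_i^*)_{i=1}^n$ be the non-increasing rearrangement of $(|x_i|)_{i=1}^n$. A norm $\|\cdot\|$ on $\mathbb R^n$ is called $K$-unconditional if for all $x,y\in\mathbb R^n$ and every permutation $\pi$ of $\{1,\dots,n\}$ one has $\|\sum_i x_ie_i\|\le K\|\sum_i x_{\pi(i)}e_i\|$, and $\|x\|\le K\|y\|$ whenever $x_i^*\le y_i^*$ for all $1\le i\le n$. For a random variable $Z$ and $p\ge 1$ put $\|Z\|_{(p)}=\sup_{1\le q\le p}\|Z\|_{L_q}/\sqrt q$. For $V\subset\mathbb R^n$ put $\ell_*(V)=\mathbb E\sup_{v\in V}|\langle G,v\rangle|$, where $G$ is the standard gaussian vector in $\mathbb R^n$. A random vector $X$ in $\mathbb R^n$ is isotropic if $\mathbb E\langle X,t\rangle^2=\|t\|_2^2$ for every $t\in\mathbb R^n$. **Theorem.** There exists an absolute constant $c_1>0$, and for all $K\ge1$, $L\ge1$ and $q_0>2$ there exists a constant $c_2>0$ that depends only on $K$, $L$ and $q_0$, for which the following holds. Let - $V\subset\mathbb R^n$ be bounded and such that $\|z\|_{V^\circ}=\sup_{v\in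 V}|\langle v,z\rangle|$ is $K$-unconditional; - $\xi$ be a random variable in $L_{q_0}$; - $X$ be an isotropic random vector in $\mathbb R^n$, not necessarily independent of $\xi$, with $$\max_{1\le j\le n}\|\langle X,e_j\rangle\|_{(p)}\le L\qquad\text{for}\quad p=\max\Bigl\{c_1\log n,\ \frac{2q_0}{q_0-2}\Bigr\}$$ (so $p=c_1\log n$ as soon as $n\ge \exp\bigl(\tfrac{2q_0}{c_1(q_0-2)}\bigr)$). If $N\ge1$ and $(X_i,\xi_i)_{i=1}^N$ are independent copies of $(X,\xi)$, then the supremum below is integrable and $$\mathbb E\sup_{v\in V}\Bigl|\frac1{\sqrt N}\sum_{i=1}^N\bigl(\xi_i\langle X_i,v\rangle-\mathbb E\,\xi\langle X,v\rangle\bigr)\Bigr|\le c_2\,\|\xi\|_{L_{q_0}}\,\ell_*(V).$$ -/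

import Mathlib

open MeasureTheory ProbabilityTheory
open scoped ENNReal

noncomputable section

/-- The non-increasing rearrangement `x^*` of `(|x_i|)_i`. -/
def decRearr {n : ℕ} (x : EuclideanSpace ℝ (Fin n)) (i : Fin n) : ℝ :=
  |x (Tuple.sort (fun j => -|x j|) i)|

theorem decRearr_antitone {n : ℕ} (x : EuclideanSpace ℝ (Fin n)) : Antitone (decRearr x) := by
  intro i j hij
  have h := Tuple.monotone_sort (fun j => -|x j|) hij
  simpa [decRearr] using h

/-- `K`-unconditionality of a (semi)norm `ν` on `ℝⁿ` with respect to the standard basis: stability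
under permutations of coordinates and monotonicity in the non-increasing rearrangement, both up to
the factor `K`. -/
def IsKUnconditional {n : ℕ} (K : ℝ) (ν : EuclideanSpace ℝ (Fin n) → ℝ) : Prop :=
  (∀ (x : EuclideanSpace ℝ (Fin n)) (π : Equiv.Perm (Fin n)),
      ν x ≤ K * ν (WithLp.toLp 2 (fun i => x (π i)))) ∧
  (∀ x y : EuclideanSpace ℝ (Fin n),
      (∀ i, decRearr x i ≤ decRearr y i) → ν x ≤ K * ν y)

/-- The norm `‖z‖_{V°} = sup_{v ∈ V} |⟨v, z⟩|`; the supremum is finite for every `z` exactly when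
`V` is bounded. -/
def polarNorm {n : ℕ} (V : Set (EuclideanSpace ℝ (Fin n))) (z : EuclideanSpace ℝ (Fin n)) : ℝ :=
  ⨆ v : V, |inner ℝ (v : EuclideanSpace ℝ (Fin n)) z|

/-- `ℓ_*(V) = E sup_{v ∈ V} |⟨G, v⟩|` with `G` a standard gaussian vector in `ℝⁿ`. -/
def ellStar {n : ℕ} (V : Set (EuclideanSpace ℝ (Fin n))) : ℝ :=
  ∫ g, (⨆ v : V, |inner ℝ g (v : EuclideanSpace ℝ (Fin n))|)
    ∂(stdGaussian (EuclideanSpace ℝ (Fin n)))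

/-- `‖Z‖_(p) = sup_{1 ≤ q ≤ p} ‖Z‖_{L_q} / √q`, with values in `[0, ∞]`. -/
def localNorm {Ω : Type*} [MeasurableSpace Ω] (P : Measure Ω) (Z : Ω → ℝ) (p : ℝ) : ℝ≥0∞ :=
  ⨆ q ∈ Set.Icc (1 : ℝ) p, eLpNorm Z (ENNReal.ofReal q) P / ENNReal.ofReal (Real.sqrt q)

/-- `X` is isotropic: `E ⟨X, t⟩² = ‖t‖²` for every `t`. (No centring is required. For `t ≠ 0` the
equation forces `⟨X, t⟩²` to be integrable.) -/
def IsIsotropic {Ω : Type*} [MeasurableSpace Ω] {n : ℕ} (P : Measure Ω)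
    (X : Ω → EuclideanSpace ℝ (Fin n)) : Prop :=
  AEMeasurable X P ∧
    ∀ t : EuclideanSpace ℝ (Fin n), ∫ ω, (inner ℝ (X ω) t) ^ 2 ∂P = ‖t‖ ^ 2

end

/-!
Write `ν = ‖·‖_{V°}`, and let `W` be the symmetrized sum `N^{-1/2} ∑ ε_i ξ_i X_i`. Unconditionality
reduces the estimate to coordinates: the gaussian mean `ℓ_*(V) = E ν(G)` is bounded below by
`ν(ρ)`, where `ρ_i = √(log (e n / i))` is the gaussian profile, and `E ν(W)` is bounded above by
the same quantity as soon as `W^*` is dominated by `ρ`.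

* Lower bound (`exists_polarNorm_gaussianProfile_le`). By Jensen's inequality `E ν(G)` dominates
  `ν(E |G|)` and `ν(E G^*)` up to the factor `K`, and `ρ ≤ 2 E G^* + 3` coordinatewise, by
  Chebyshev's inequality for the number of large coordinates of `G`.
* Domination (`decRearr_le_mul_gaussianProfile`). If the power sums `(1 / n) ∑_j Y_j^{2k}` are of
  order `(C k)^k` for all `k ≤ log (e n)`, then `Y^* ≤ C' ρ`. The domination constant depends on
  the power sums in an affine way, so it suffices to control the moments of the single coordinates.
* Moments of one coordinate (`exists_signAvg_moment_bound`). The multipliers `ξ_i` have few moments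
  and are not independent of the `X_i`, so they are removed first: with the signs averaged, the
  moments of `∑ ε_i ξ_i x_i` are bounded *for every* `ξ` by the empirical `L_{q₀}` norm of `ξ` times
  a function of `x` only. For this the coordinates `i` are split at the level
  `|x_i|^{2 q₀ / (q₀ - 2)} = N / k`. The few large ones are treated by the triangle inequality, the
  others by Khintchine's inequality, and Hölder's inequality separates `ξ` from `x` in both cases
  (`signAvg_pow_le_of_split`). The resulting truncated power sums of the independent variables
  `x_i` are estimated through exponential moments (`lintegral_pi_smallPart_le`) and through
  `∑ y_i ≤ ∏ (1 + y_i)` (`lintegral_pi_bigPart_le`). The moment of order `2 q₀ / (q₀ - 2)` and the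
  subgaussian growth up to order `4 k ≈ log n` are exactly what these two estimates use.
* Symmetrization (`integral_polarNorm_sum_le_two_mul`). It holds for every fixed choice of signs, by
  splitting the sum according to the sign.
-/

/-! ### The polar seminorm of a bounded set -/

section PolarNorm

variable {n : ℕ} {V : Set (EuclideanSpace ℝ (Fin n))}

theorem exists_forall_abs_inner_le (hV : Bornology.IsBounded V) :
    ∃ R, 0 ≤ R ∧ ∀ z, ∀ v : V, |inner ℝ (v : EuclideanSpace ℝ (Fin n)) z| ≤ R * ‖z‖ := by
  obtain ⟨R, hR⟩ := hV.exists_norm_le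
  refine ⟨max R 0, le_max_right _ _, fun z v => (abs_real_inner_le_norm _ _).trans ?_⟩
  gcongr
  exact (hR v v.2).trans (le_max_left _ _)

theorem abs_inner_le_polarNorm (hV : Bornology.IsBounded V) (z : EuclideanSpace ℝ (Fin n))
    (v : V) : |inner ℝ (v : EuclideanSpace ℝ (Fin n)) z| ≤ polarNorm V z := by
  obtain ⟨R, -, hR⟩ := exists_forall_abs_inner_le hV
  exact le_ciSup (f := fun v : V => |inner ℝ (v : EuclideanSpace ℝ (Fin n)) z|)
    ⟨R * ‖z‖, by rintro _ ⟨v, rfl⟩; exact hR z v⟩ v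

theorem polarNorm_nonneg (z : EuclideanSpace ℝ (Fin n)) : 0 ≤ polarNorm V z :=
  Real.iSup_nonneg fun _ => abs_nonneg _

theorem polarNorm_le {z : EuclideanSpace ℝ (Fin n)} {c : ℝ} (hc : 0 ≤ c)
    (h : ∀ v : V, |inner ℝ (v : EuclideanSpace ℝ (Fin n)) z| ≤ c) : polarNorm V z ≤ c :=
  Real.iSup_le h hc

theorem exists_polarNorm_le (hV : Bornology.IsBounded V) :
    ∃ R, 0 ≤ R ∧ ∀ z, polarNorm V z ≤ R * ‖z‖ := by
  obtain ⟨R, hR0, hR⟩ := exists_forall_abs_inner_le hV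
  exact ⟨R, hR0, fun z => polarNorm_le (by positivity) (hR z)⟩

theorem polarNorm_add_le (hV : Bornology.IsBounded V) (x y : EuclideanSpace ℝ (Fin n)) :
    polarNorm V (x + y) ≤ polarNorm V x + polarNorm V y := by
  refine polarNorm_le (add_nonneg (polarNorm_nonneg _) (polarNorm_nonneg _)) fun v => ?_
  rw [inner_add_right]
  exact (abs_add_le _ _).trans
    (add_le_add (abs_inner_le_polarNorm hV x v) (abs_inner_le_polarNorm hV y v))

theorem polarNorm_smul (c : ℝ) (x : EuclideanSpace ℝ (Fin n)) :
    polarNorm V (c • x) = |c| * polarNorm V x := by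
  simp only [polarNorm, inner_smul_right, abs_mul]
  rw [Real.mul_iSup_of_nonneg (abs_nonneg c)]

theorem polarNorm_neg (x : EuclideanSpace ℝ (Fin n)) : polarNorm V (-x) = polarNorm V x := by
  simp [polarNorm]

theorem continuous_polarNorm (hV : Bornology.IsBounded V) : Continuous (polarNorm V) := by
  obtain ⟨R, hR0, hR⟩ := exists_polarNorm_le hV
  refine (LipschitzWith.of_le_add_mul ⟨R, hR0⟩ fun x y => ?_).continuous
  have h := polarNorm_add_le hV y (x - y)
  rw [add_sub_cancel] at h
  rw [dist_eq_norm]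
  exact h.trans (add_le_add_right (hR _) _)

theorem integrable_polarNorm {Ω : Type*} [MeasurableSpace Ω] {P : Measure Ω}
    (hV : Bornology.IsBounded V) {Z : Ω → EuclideanSpace ℝ (Fin n)} (hZ : Integrable Z P) :
    Integrable (fun ω => polarNorm V (Z ω)) P := by
  obtain ⟨R, hR0, hR⟩ := exists_polarNorm_le hV
  refine (hZ.norm.const_mul R).mono'
    ((continuous_polarNorm hV).comp_aestronglyMeasurable hZ.aestronglyMeasurable) ?_
  filter_upwards with ω
  rw [Real.norm_of_nonneg (polarNorm_nonneg _)]
  exact hR _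

/-- Jensen's inequality for the polar seminorm. -/
theorem polarNorm_integral_le {Ω : Type*} [MeasurableSpace Ω] {P : Measure Ω}
    (hV : Bornology.IsBounded V) {Z : Ω → EuclideanSpace ℝ (Fin n)} (hZ : Integrable Z P) :
    polarNorm V (∫ ω, Z ω ∂P) ≤ ∫ ω, polarNorm V (Z ω) ∂P := by
  refine polarNorm_le (integral_nonneg fun _ => polarNorm_nonneg _) fun v => ?_
  rw [← integral_inner hZ]
  refine (abs_integral_le_integral_abs).trans ?_
  exact integral_mono (hZ.const_inner _).abs (integrable_polarNorm hV hZ)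
    fun ω => abs_inner_le_polarNorm hV _ v

end PolarNorm

/-! ### Non-increasing rearrangements -/

section Rearrangement

variable {n : ℕ}

theorem decRearr_nonneg (x : EuclideanSpace ℝ (Fin n)) (i : Fin n) : 0 ≤ decRearr x i :=
  abs_nonneg _

theorem decRearr_of_antitone {x : EuclideanSpace ℝ (Fin n)} (hx : Antitone fun i => x i)
    (h0 : ∀ i, 0 ≤ x i) (i : Fin n) : decRearr x i = x i := by
  have h : Tuple.sort (fun j => -|x j|) = Equiv.refl _ := by
    rw [Tuple.sort_eq_refl_iff_monotone]
    intro i j hij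
    simpa [abs_of_nonneg (h0 _)] using hx hij
  rw [decRearr, h, Equiv.refl_apply, abs_of_nonneg (h0 _)]

theorem decRearr_congr_abs {x y : EuclideanSpace ℝ (Fin n)} (h : ∀ i, |x i| = |y i|) :
    decRearr x = decRearr y := by
  ext i
  simp [decRearr, h]

theorem decRearr_decRearr (x : EuclideanSpace ℝ (Fin n)) (i : Fin n) :
    decRearr (WithLp.toLp 2 (decRearr x)) i = decRearr x i :=
  decRearr_of_antitone (decRearr_antitone x) (decRearr_nonneg x) i

theorem sum_comp_decRearr (x : EuclideanSpace ℝ (Fin n)) (f : ℝ → ℝ) :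
    ∑ i, f (decRearr x i) = ∑ j, f |x j| :=
  Equiv.sum_comp (Tuple.sort fun j => -|x j|) fun j => f |x j|

theorem succ_mul_decRearr_pow_le (x : EuclideanSpace ℝ (Fin n)) (i : Fin n) (m : ℕ) :
    ((i : ℕ) + 1 : ℝ) * decRearr x i ^ m ≤ ∑ j, |x j| ^ m := by
  rw [← sum_comp_decRearr x fun t => t ^ m]
  calc ((i : ℕ) + 1 : ℝ) * decRearr x i ^ m = ∑ l ∈ Finset.Iic i, decRearr x i ^ m := by
        simp [Fin.card_Iic]
    _ ≤ ∑ l ∈ Finset.Iic i, decRearr x l ^ m := by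
        refine Finset.sum_le_sum fun l hl => ?_
        exact pow_le_pow_left₀ (decRearr_nonneg x i)
          (decRearr_antitone x (Finset.mem_Iic.mp hl)) m
    _ ≤ _ := Finset.sum_le_sum_of_subset_of_nonneg (Finset.subset_univ _)
        fun l _ _ => pow_nonneg (decRearr_nonneg x l) m

/-- At least `i + 1` coordinates of modulus `≥ t` force `x^*_i ≥ t` (indices start at `0`). -/
theorem le_decRearr_of_lt_sum_indicator (x : EuclideanSpace ℝ (Fin n)) (i : Fin n) (t : ℝ)
    (h : ((i : ℕ) : ℝ) < ∑ j, if t ≤ |x j| then (1 : ℝ) else 0) : t ≤ decRearr x i := by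
  by_contra! hlt
  rw [← sum_comp_decRearr x fun u => if t ≤ u then (1 : ℝ) else 0] at h
  have : ∑ l, (if t ≤ decRearr x l then (1 : ℝ) else 0)
      ≤ ∑ l, if l ∈ Finset.Iio i then (1 : ℝ) else 0 := by
    refine Finset.sum_le_sum fun l _ => ?_
    by_cases hl : l < i
    · simp only [Finset.mem_Iio, hl, if_true]
      split_ifs <;> norm_num
    · have := decRearr_antitone x (not_lt.mp hl)
      simp [hl, not_le.mpr (this.trans_lt hlt)]
  have h2 : ∑ l, (if l ∈ Finset.Iio i then (1 : ℝ) else 0) = (i : ℕ) := by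
    rw [Finset.sum_ite_mem]
    simp [Fin.card_Iio]
  linarith

theorem IsKUnconditional.polarNorm_le_mul {K : ℝ} {V : Set (EuclideanSpace ℝ (Fin n))}
    (hK : IsKUnconditional K (polarNorm V)) {x y : EuclideanSpace ℝ (Fin n)} {θ : ℝ} (hθ : 0 ≤ θ)
    (hy : Antitone fun i => y i) (hy0 : ∀ i, 0 ≤ y i) (h : ∀ i, decRearr x i ≤ θ * y i) :
    polarNorm V x ≤ K * (θ * polarNorm V y) := by
  have := hK.2 x (θ • y) fun i => by
    rw [decRearr_of_antitone (x := θ • y)]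
    · simpa using h i
    · intro i j hij
      simpa using mul_le_mul_of_nonneg_left (hy hij) hθ
    · intro i
      simpa using mul_nonneg hθ (hy0 i)
  rwa [polarNorm_smul, abs_of_nonneg hθ] at this

/-- The vector with coordinates `√(log (e n / i))`, `1 ≤ i ≤ n` (so `√(1 + log (n / (i + 1)))` for
`i : Fin n`): up to constants, the typical non-increasing rearrangement of a standard gaussian
vector. -/
noncomputable def gaussianProfile (n : ℕ) : EuclideanSpace ℝ (Fin n) :=
  WithLp.toLp 2 fun i => Real.sqrt (1 + Real.log (n / ((i : ℕ) + 1)))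

theorem gaussianProfile_apply (i : Fin n) :
    gaussianProfile n i = Real.sqrt (1 + Real.log (n / ((i : ℕ) + 1))) := rfl

theorem log_div_succ_nonneg (i : Fin n) : 0 ≤ Real.log (n / ((i : ℕ) + 1)) := by
  refine Real.log_nonneg ?_
  rw [one_le_div (by positivity)]
  exact_mod_cast i.2

theorem gaussianProfile_nonneg (i : Fin n) : 0 ≤ gaussianProfile n i := Real.sqrt_nonneg _

theorem one_le_gaussianProfile (i : Fin n) : 1 ≤ gaussianProfile n i := by
  rw [gaussianProfile_apply, Real.one_le_sqrt]
  linarith [log_div_succ_nonneg i]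

theorem gaussianProfile_antitone : Antitone fun i => gaussianProfile n i := by
  intro i j hij
  have hn : (0 : ℝ) < n := by exact_mod_cast i.pos
  have : ((i : ℕ) : ℝ) ≤ (j : ℕ) := by exact_mod_cast hij
  simp only [gaussianProfile_apply]
  gcongr

/-- If the normalized even power sums of the coordinates of `Y` behave as for a subgaussian vector
up to order `≈ log n`, then `Y^*` is dominated by the gaussian profile. The dependence on the power
sums is affine, hence compatible with taking expectations. -/
theorem decRearr_le_mul_gaussianProfile (Y : EuclideanSpace ℝ (Fin n)) {C Ψ : ℝ} (hC : 0 < C)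
    (hΨ : Ψ = 2 + ∑ k ∈ Finset.Icc 1 ⌈1 + Real.log n⌉₊,
      2 * (1 / 2) ^ k * ((∑ j, Y j ^ (2 * k)) / (n * (C * k) ^ k))) (i : Fin n) :
    decRearr Y i ≤ Real.sqrt (2 * Real.exp 1 * C * Ψ) * gaussianProfile n i := by
  have hn : (0 : ℝ) < n := by exact_mod_cast i.pos
  set l := 1 + Real.log (n / ((i : ℕ) + 1)) with hl
  have hl1 : 1 ≤ l := by linarith [log_div_succ_nonneg i]
  set k := ⌈l⌉₊ with hk
  have hk1 : 1 ≤ k := Nat.one_le_ceil_iff.mpr (by linarith)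
  have hkl : l ≤ k := Nat.le_ceil l
  have hk2 : (k : ℝ) ≤ 2 * l := by
    have := Nat.ceil_lt_add_one (show 0 ≤ l by linarith)
    linarith
  have hkQ : k ≤ ⌈1 + Real.log n⌉₊ := by
    refine Nat.ceil_le_ceil ?_
    rw [hl]
    have : (n : ℝ) / ((i : ℕ) + 1) ≤ n := div_le_self hn.le (by simp)
    have := Real.log_le_log (by positivity) this
    linarith
  have hk0 : (0 : ℝ) < k := by exact_mod_cast hk1
  set F := (∑ j, Y j ^ (2 * k)) / (n * (C * k) ^ k) with hF
  have hS0 : ∀ k : ℕ, 0 ≤ ∑ j, Y j ^ (2 * k) := fun k =>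
    Finset.sum_nonneg fun j _ => by rw [pow_mul]; positivity
  have hF0 : 0 ≤ F := div_nonneg (hS0 k) (by positivity)
  have hΨF : 2 + 2 * (1 / 2) ^ k * F ≤ Ψ := by
    rw [hΨ]
    gcongr
    refine Finset.single_le_sum (f := fun k : ℕ => 2 * (1 / 2 : ℝ) ^ k *
      ((∑ j, Y j ^ (2 * k)) / (n * (C * k) ^ k))) (fun k _ => ?_) (Finset.mem_Icc.mpr ⟨hk1, hkQ⟩)
    exact mul_nonneg (by positivity) (div_nonneg (hS0 k) (by positivity))
  have hΨ0 : 0 < Ψ := by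
    have : 0 ≤ 2 * (1 / 2 : ℝ) ^ k * F := by positivity
    linarith
  -- `F = 2 ^ k * u` with `u ≤ (1 + u) ^ k`
  have hFΨ : F ≤ Ψ ^ k := by
    have hu : 0 ≤ (1 / 2 : ℝ) ^ k * F := by positivity
    calc F = 2 ^ k * ((1 / 2) ^ k * F) := by
          rw [← mul_assoc, ← mul_pow]; norm_num
      _ ≤ 2 ^ k * (1 + (1 / 2) ^ k * F) ^ k := by
          gcongr
          exact (by linarith : (1 / 2 : ℝ) ^ k * F ≤ 1 + (1 / 2) ^ k * F).trans
            (le_self_pow₀ (by linarith) (by omega))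
      _ = (2 + 2 * (1 / 2) ^ k * F) ^ k := by rw [← mul_pow]; ring
      _ ≤ Ψ ^ k := by gcongr
  have hexp : (n : ℝ) / ((i : ℕ) + 1) ≤ Real.exp 1 ^ k := by
    rw [← Real.exp_nat_mul, mul_one, ← Real.log_le_iff_le_exp (by positivity)]
    linarith
  have hpow : (decRearr Y i ^ 2) ^ k ≤ (Real.exp 1 * C * k * Ψ) ^ k := by
    have h1 := succ_mul_decRearr_pow_le Y i (2 * k)
    have h2 : ∑ j, |Y j| ^ (2 * k) = F * (n * (C * k) ^ k) := by
      rw [hF, div_mul_cancel₀ _ (by positivity)]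
      simp [pow_mul]
    rw [h2] at h1
    rw [← pow_mul]
    calc decRearr Y i ^ (2 * k) ≤ F * (n * (C * k) ^ k) / ((i : ℕ) + 1) := by
          rw [le_div_iff₀ (by positivity)]; linarith
      _ = n / ((i : ℕ) + 1) * (C * k) ^ k * F := by ring
      _ ≤ Real.exp 1 ^ k * (C * k) ^ k * Ψ ^ k := by gcongr
      _ = _ := by rw [← mul_pow, ← mul_pow]; ring
  have hsq : decRearr Y i ^ 2 ≤ 2 * Real.exp 1 * C * Ψ * l := by
    refine (le_of_pow_le_pow_left₀ (by omega) (by positivity) hpow).trans ?_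
    calc Real.exp 1 * C * k * Ψ ≤ Real.exp 1 * C * (2 * l) * Ψ := by gcongr
      _ = _ := by ring
  rw [gaussianProfile_apply, ← hl, ← Real.sqrt_mul (by positivity)]
  exact Real.le_sqrt_of_sq_le hsq

end Rearrangement

/-! ### Averages over signs -/

section Signs

variable {N : ℕ}

/-- The sign `±1` encoded by a Boolean. -/
def boolSign (b : Bool) : ℝ := if b then 1 else -1

/-- The average of `f` over all `2 ^ N` choices of signs. -/
noncomputable def signAvg (f : (Fin N → Bool) → ℝ) : ℝ := (2 ^ N)⁻¹ * ∑ s, f s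

theorem abs_boolSign (b : Bool) : |boolSign b| = 1 := by cases b <;> simp [boolSign]

theorem signAvg_mono {f g : (Fin N → Bool) → ℝ} (h : ∀ s, f s ≤ g s) : signAvg f ≤ signAvg g :=
  mul_le_mul_of_nonneg_left (Finset.sum_le_sum fun s _ => h s) (by positivity)

theorem signAvg_nonneg {f : (Fin N → Bool) → ℝ} (h : ∀ s, 0 ≤ f s) : 0 ≤ signAvg f :=
  mul_nonneg (by positivity) (Finset.sum_nonneg fun s _ => h s)

theorem signAvg_add (f g : (Fin N → Bool) → ℝ) :
    signAvg (fun s => f s + g s) = signAvg f + signAvg g := by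
  simp [signAvg, Finset.sum_add_distrib, mul_add]

theorem signAvg_const_mul (c : ℝ) (f : (Fin N → Bool) → ℝ) :
    signAvg (fun s => c * f s) = c * signAvg f := by
  simp only [signAvg, ← Finset.mul_sum]; ring

theorem signAvg_const (c : ℝ) : signAvg (fun _ : Fin N → Bool => c) = c := by
  simp [signAvg]

theorem signAvg_sum {ι : Type*} (t : Finset ι) (f : ι → (Fin N → Bool) → ℝ) :
    signAvg (fun s => ∑ j ∈ t, f j s) = ∑ j ∈ t, signAvg (f j) := by
  simp only [signAvg, ← Finset.mul_sum]
  rw [Finset.sum_comm]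

theorem signAvg_exp (b : Fin N → ℝ) :
    signAvg (fun s => Real.exp (∑ i, boolSign (s i) * b i)) = ∏ i, Real.cosh (b i) := by
  have h : ∀ i, Real.cosh (b i) = 2⁻¹ * ∑ c : Bool, Real.exp (boolSign c * b i) := by
    intro i
    simp [boolSign, Real.cosh_eq]; ring
  simp only [h, Finset.prod_mul_distrib, Finset.prod_univ_sum, Fintype.piFinset_univ, signAvg,
    Real.exp_sum]
  simp

theorem signAvg_exp_le (b : Fin N → ℝ) :
    signAvg (fun s => Real.exp (∑ i, boolSign (s i) * b i)) ≤ Real.exp ((∑ i, b i ^ 2) / 2) := by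
  rw [signAvg_exp, Finset.sum_div, Real.exp_sum]
  exact Finset.prod_le_prod (fun i _ => (Real.cosh_pos _).le)
    fun i _ => Real.cosh_le_exp_half_sq _

theorem pow_two_mul_div_factorial_le_cosh (x : ℝ) (k : ℕ) :
    x ^ (2 * k) / (2 * k).factorial ≤ Real.cosh x :=
  le_hasSum (Real.hasSum_cosh x) k fun j _ => div_nonneg (by rw [pow_mul]; positivity)
    (by positivity)

/-- Khintchine's inequality for even moments, with the growth `√k` of the constants. -/
theorem signAvg_pow_le (b : Fin N → ℝ) {k : ℕ} (hk : 1 ≤ k) :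
    signAvg (fun s => (∑ i, boolSign (s i) * b i) ^ (2 * k))
      ≤ (2 * Real.exp 1 * k) ^ k * (∑ i, b i ^ 2) ^ k := by
  have hk0 : (0 : ℝ) < k := by exact_mod_cast hk
  set v := ∑ i, b i ^ 2 with hv
  have hv0 : 0 ≤ v := Finset.sum_nonneg fun i _ => sq_nonneg _
  rcases hv0.eq_or_lt with h0 | hvpos
  · have hb : ∀ i, b i = 0 := fun i => by
      have := (Finset.sum_eq_zero_iff_of_nonneg fun i _ => sq_nonneg (b i)).mp (hv ▸ h0.symm) i
        (Finset.mem_univ i)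
      simpa using this
    have : (2 * k) ≠ 0 := by omega
    simp [hb, this, signAvg_const]
    positivity
  -- the exponential moment is used at the scale `c` with `c ^ 2 * v = 2 * k`
  set c := Real.sqrt (2 * k / v) with hc
  have hc2 : c ^ 2 = 2 * k / v := Real.sq_sqrt (by positivity)
  have key : signAvg (fun s => (c * ∑ i, boolSign (s i) * b i) ^ (2 * k) / (2 * k).factorial)
      ≤ Real.exp k := by
    have hexp : ∀ c' : ℝ, c' ^ 2 = 2 * k / v →
        signAvg (fun s => Real.exp (c' * ∑ i, boolSign (s i) * b i)) ≤ Real.exp k := by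
      intro c' hc'
      have := signAvg_exp_le fun i => c' * b i
      simp only [mul_pow, ← Finset.mul_sum, hc', ← hv] at this
      rw [div_mul_cancel₀ _ hvpos.ne', mul_div_cancel_left₀ _ two_ne_zero] at this
      refine le_trans (le_of_eq ?_) this
      congr 1; ext s
      rw [Finset.mul_sum]
      congr 1
      exact Finset.sum_congr rfl fun i _ => by ring
    calc _ ≤ signAvg (fun s => (1 / 2) * Real.exp (c * ∑ i, boolSign (s i) * b i)
            + (1 / 2) * Real.exp (-c * ∑ i, boolSign (s i) * b i)) := by
          refine signAvg_mono fun s => (pow_two_mul_div_factorial_le_cosh _ k).trans ?_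
          rw [Real.cosh_eq, neg_mul]; apply le_of_eq; ring
      _ ≤ _ := by
          rw [signAvg_add, signAvg_const_mul, signAvg_const_mul]
          linarith [hexp c hc2, hexp (-c) (by rw [neg_sq, hc2])]
  have hfac : ((2 * k).factorial : ℝ) ≤ (2 * k) ^ k * (2 * k) ^ k := by
    rw [← pow_add, ← two_mul]
    exact_mod_cast Nat.factorial_le_pow (2 * k)
  have e1 : ∀ s : Fin N → Bool, (c * ∑ i, boolSign (s i) * b i) ^ (2 * k) / (2 * k).factorial
      = ((2 * k / v) ^ k / (2 * k).factorial) * (∑ i, boolSign (s i) * b i) ^ (2 * k) := by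
    intro s
    rw [mul_pow, pow_mul c, hc2]; ring
  simp only [e1, signAvg_const_mul] at key
  have hf0 : (0 : ℝ) < (2 * k).factorial := by positivity
  rw [div_mul_eq_mul_div, div_le_iff₀ hf0, div_pow, div_mul_eq_mul_div,
    div_le_iff₀ (by positivity)] at key
  have h2k : (0 : ℝ) < (2 * k) ^ k := by positivity
  refine le_of_mul_le_mul_left (key.trans ?_) h2k
  calc Real.exp k * (2 * k).factorial * v ^ k
      ≤ Real.exp k * ((2 * k) ^ k * (2 * k) ^ k) * v ^ k := by gcongr
    _ = _ := by
      rw [show (k : ℝ) = k * 1 by ring, Real.exp_nat_mul]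
      simp only [mul_one, mul_pow]; ring

/-- A Rademacher sum `∑ ε_i ξ_i x_i`: for the coordinates in `I` the triangle inequality is used,
for the others Khintchine's inequality; in both cases Hölder's inequality separates `ξ`, which
enters only through its empirical `L_q` norm, from `x`. -/
theorem signAvg_pow_le_of_split {q a r δ : ℝ} (hN : 1 ≤ N) (hqa : q.HolderConjugate a)
    (hqr : (q / 2).HolderConjugate r) (hδ : δ = 1 / 2 - 1 / q) {k : ℕ} (hk : 1 ≤ k)
    (ξ x : Fin N → ℝ) (I : Finset (Fin N)) :
    signAvg (fun s => ((Real.sqrt N)⁻¹ * ∑ i, boolSign (s i) * (ξ i * x i)) ^ (2 * k))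
      ≤ (((∑ i, |ξ i| ^ q) / N) ^ (1 / q)) ^ (2 * k) *
        (4 ^ k * (((N : ℝ) ^ (-δ) * (∑ i ∈ I, |x i| ^ a) ^ (1 / a)) ^ (2 * k)
          + (2 * Real.exp 1 * k) ^ k * (((∑ i ∈ Iᶜ, |x i| ^ (2 * r)) / N) ^ (1 / r)) ^ k)) := by
  have hN0 : (0 : ℝ) < N := by exact_mod_cast hN
  have hk0 : (0 : ℝ) < k := by exact_mod_cast hk
  have hq0 : 0 < q := hqa.pos
  have hdiv : ∀ u p : ℝ, u / (N : ℝ) ^ p = u * (N : ℝ) ^ (-p) := fun u p => by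
    rw [Real.rpow_neg hN0.le, div_eq_mul_inv]
  set E := ∑ i, |ξ i| ^ q with hE
  have hE0 : 0 ≤ E := Finset.sum_nonneg fun i _ => by positivity
  set A := (E / N) ^ (1 / q) with hA
  have hA0 : 0 ≤ A := by positivity
  set S := ∑ i ∈ I, |x i| ^ a with hS
  have hS0 : 0 ≤ S := Finset.sum_nonneg fun i _ => by positivity
  set T := ∑ i ∈ Iᶜ, |x i| ^ (2 * r) with hT
  have hT0 : 0 ≤ T := Finset.sum_nonneg fun i _ => by positivity
  have hbig : ∀ s : Fin N → Bool, |(Real.sqrt N)⁻¹ * ∑ i ∈ I, boolSign (s i) * (ξ i * x i)|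
      ≤ A * ((N : ℝ) ^ (-δ) * S ^ (1 / a)) := by
    intro s
    have h1 : |∑ i ∈ I, boolSign (s i) * (ξ i * x i)| ≤ E ^ (1 / q) * S ^ (1 / a) := by
      calc _ ≤ ∑ i ∈ I, |ξ i| * |x i| := by
            refine (Finset.abs_sum_le_sum_abs _ _).trans (le_of_eq ?_)
            exact Finset.sum_congr rfl fun i _ => by rw [abs_mul, abs_boolSign, one_mul, abs_mul]
        _ ≤ (∑ i ∈ I, |ξ i| ^ q) ^ (1 / q) * S ^ (1 / a) := by
            simpa using Real.inner_le_Lp_mul_Lq I (fun i => |ξ i|) (fun i => |x i|) hqa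
        _ ≤ _ := by
            gcongr
            exact Finset.sum_le_sum_of_subset_of_nonneg (Finset.subset_univ _)
              fun i _ _ => by positivity
    have h2 : (Real.sqrt N)⁻¹ * E ^ (1 / q) = A * (N : ℝ) ^ (-δ) := by
      rw [hA, Real.div_rpow hE0 hN0.le, Real.sqrt_eq_rpow, ← Real.rpow_neg hN0.le, hδ,
        hdiv, mul_assoc, ← Real.rpow_add hN0, mul_comm]
      congr 2; ring
    rw [abs_mul, abs_of_nonneg (by positivity)]
    calc _ ≤ (Real.sqrt N)⁻¹ * (E ^ (1 / q) * S ^ (1 / a)) := by gcongr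
      _ = _ := by rw [← mul_assoc, h2, mul_assoc]
  set b : Fin N → ℝ := fun i => if i ∈ Iᶜ then (Real.sqrt N)⁻¹ * (ξ i * x i) else 0 with hb
  have hbsum : ∀ s : Fin N → Bool, ∑ i, boolSign (s i) * b i
      = (Real.sqrt N)⁻¹ * ∑ i ∈ Iᶜ, boolSign (s i) * (ξ i * x i) := by
    intro s
    simp only [hb, mul_ite, mul_zero]
    rw [Finset.sum_ite_mem, Finset.univ_inter, Finset.mul_sum]
    exact Finset.sum_congr rfl fun i _ => by ring
  have hsmall : ∑ i, b i ^ 2 ≤ A ^ 2 * (T / N) ^ (1 / r) := by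
    have h1 : ∑ i, b i ^ 2 = (N : ℝ)⁻¹ * ∑ i ∈ Iᶜ, ξ i ^ 2 * x i ^ 2 := by
      simp only [hb, ite_pow]
      rw [zero_pow two_ne_zero, Finset.sum_ite_mem, Finset.univ_inter, Finset.mul_sum]
      refine Finset.sum_congr rfl fun i _ => ?_
      rw [mul_pow, inv_pow, Real.sq_sqrt hN0.le, mul_pow]
    have hpow : ∀ (y p : ℝ), |y ^ 2| ^ p = |y| ^ (2 * p) := fun y p => by
      rw [abs_of_nonneg (sq_nonneg y), ← sq_abs, Real.rpow_mul (abs_nonneg _)]; simp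
    have h2 : ∑ i ∈ Iᶜ, ξ i ^ 2 * x i ^ 2 ≤ E ^ (2 / q) * T ^ (1 / r) := by
      have := Real.inner_le_Lp_mul_Lq Iᶜ (fun i => ξ i ^ 2) (fun i => x i ^ 2) hqr
      simp only [hpow, ← hT] at this
      refine this.trans ?_
      rw [show 2 * (q / 2) = q by ring, show 1 / (q / 2) = 2 / q by field_simp]
      gcongr
      exact Finset.sum_le_sum_of_subset_of_nonneg (Finset.subset_univ _)
          fun i _ _ => by positivity
    have h3 : A ^ 2 = (E / N) ^ (2 / q) := by
      rw [hA, ← Real.rpow_natCast, ← Real.rpow_mul (by positivity)]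
      congr 1; push_cast; ring
    have h4 : (N : ℝ)⁻¹ = (N : ℝ) ^ (-(2 / q)) * (N : ℝ) ^ (-(1 / r)) := by
      have := hqr.inv_add_inv_eq_one
      rw [← Real.rpow_add hN0, ← Real.rpow_neg_one]
      congr 1
      rw [inv_div] at this
      rw [one_div]; linarith
    rw [h1, h3, Real.div_rpow hE0 hN0.le, Real.div_rpow hT0 hN0.le, hdiv, hdiv, h4]
    calc _ ≤ (N : ℝ) ^ (-(2 / q)) * (N : ℝ) ^ (-(1 / r)) * (E ^ (2 / q) * T ^ (1 / r)) := by gcongr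
      _ = _ := by ring
  have hsplit : ∀ s : Fin N → Bool,
      ((Real.sqrt N)⁻¹ * ∑ i, boolSign (s i) * (ξ i * x i)) ^ (2 * k)
        ≤ 4 ^ k * ((A * ((N : ℝ) ^ (-δ) * S ^ (1 / a))) ^ (2 * k)
          + (∑ i, boolSign (s i) * b i) ^ (2 * k)) := by
    intro s
    rw [← Finset.sum_add_sum_compl I, mul_add, ← hbsum s]
    have h1 := (even_two_mul k).add_pow_le (a := (Real.sqrt N)⁻¹ * ∑ i ∈ I, boolSign (s i) *
      (ξ i * x i)) (b := ∑ i, boolSign (s i) * b i)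
    have h2 : ((Real.sqrt N)⁻¹ * ∑ i ∈ I, boolSign (s i) * (ξ i * x i)) ^ (2 * k)
        ≤ (A * ((N : ℝ) ^ (-δ) * S ^ (1 / a))) ^ (2 * k) := by
      rw [← (even_two_mul k).pow_abs]
      exact pow_le_pow_left₀ (abs_nonneg _) (hbig s) _
    have h3 : (2 : ℝ) ^ (2 * k - 1) ≤ 4 ^ k := by
      rw [show (4 : ℝ) = 2 ^ 2 by norm_num, ← pow_mul]
      exact pow_le_pow_right₀ (by norm_num) (by omega)
    refine h1.trans ?_
    have h4 : 0 ≤ (∑ i, boolSign (s i) * b i) ^ (2 * k) := by rw [pow_mul]; positivity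
    have h5 : 0 ≤ ((Real.sqrt N)⁻¹ * ∑ i ∈ I, boolSign (s i) * (ξ i * x i)) ^ (2 * k) := by
      rw [pow_mul]; positivity
    gcongr
  calc _ ≤ _ := signAvg_mono hsplit
    _ = 4 ^ k * ((A * ((N : ℝ) ^ (-δ) * S ^ (1 / a))) ^ (2 * k)
          + signAvg fun s => (∑ i, boolSign (s i) * b i) ^ (2 * k)) := by
        rw [signAvg_const_mul, signAvg_add, signAvg_const]
    _ ≤ 4 ^ k * ((A * ((N : ℝ) ^ (-δ) * S ^ (1 / a))) ^ (2 * k)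
          + (2 * Real.exp 1 * k) ^ k * (A ^ 2 * (T / N) ^ (1 / r)) ^ k) := by
        gcongr
        refine (signAvg_pow_le b hk).trans ?_
        gcongr
    _ = _ := by
        rw [mul_pow A, mul_pow (A ^ 2), ← pow_mul]; ring

end Signs

/-! ### Moments of truncated power sums of independent variables -/

section PowerSums

variable {N : ℕ}

theorem lintegral_pi_prod_le (μ : Fin N → Measure ℝ) [∀ i, IsProbabilityMeasure (μ i)]
    {f : ℝ → ℝ} (hf : Measurable f) (hf0 : ∀ u, 0 ≤ f u) {c : ℝ} (hc : 0 ≤ c)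
    (h : ∀ i, ∫⁻ u, ENNReal.ofReal (f u) ∂(μ i) ≤ ENNReal.ofReal c) :
    ∫⁻ x, ENNReal.ofReal (∏ i, f (x i)) ∂(Measure.pi μ) ≤ ENNReal.ofReal (c ^ N) := by
  have hind : iIndepFun (fun i (x : Fin N → ℝ) => ENNReal.ofReal (f (x i))) (Measure.pi μ) :=
    iIndepFun_pi (X := fun _ u => ENNReal.ofReal (f u)) fun i => by fun_prop
  have hm : ∀ i, Measurable (fun x : Fin N → ℝ => ENNReal.ofReal (f (x i))) := fun i => by fun_prop
  simp only [ENNReal.ofReal_prod_of_nonneg fun i _ => hf0 _]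
  rw [lintegral_prod_eq_prod_lintegral_of_indepFun _ _ hind hm]
  calc _ ≤ ∏ _i : Fin N, ENNReal.ofReal c := by
        refine Finset.prod_le_prod' fun i _ => ?_
        rw [← lintegral_map' (f := fun u => ENNReal.ofReal (f u)) (g := fun x : Fin N → ℝ => x i)
          (by fun_prop) (measurable_pi_apply i).aemeasurable, (measurePreserving_eval μ i).map_eq]
        exact h i
    _ = _ := by simp [ENNReal.ofReal_pow hc]

theorem lintegral_ofReal_le_of_le_mul {μ : Measure ℝ} {f g : ℝ → ℝ} {c m b : ℝ} (hc : 0 ≤ c)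
    (hg : ∫⁻ u, ENNReal.ofReal (g u) ∂μ ≤ ENNReal.ofReal m) (hfg : ∀ u, f u ≤ c * g u)
    (hb : c * m ≤ b) : ∫⁻ u, ENNReal.ofReal (f u) ∂μ ≤ ENNReal.ofReal b :=
  calc _ ≤ ∫⁻ u, ENNReal.ofReal c * ENNReal.ofReal (g u) ∂μ := by
        refine lintegral_mono fun u => ?_
        rw [← ENNReal.ofReal_mul hc]
        exact ENNReal.ofReal_le_ofReal (hfg u)
    _ = ENNReal.ofReal c * ∫⁻ u, ENNReal.ofReal (g u) ∂μ :=
        lintegral_const_mul' _ _ ENNReal.ofReal_ne_top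
    _ ≤ ENNReal.ofReal c * ENNReal.ofReal m := by gcongr
    _ ≤ _ := by
        rw [← ENNReal.ofReal_mul hc]
        exact ENNReal.ofReal_le_ofReal hb

/-- The `k`-th moment of an empirical `p`-th moment, truncated at the level `M` with
`M ^ p = N / k`: at this level the exponential moments of `k` times the sum are under control. -/
theorem lintegral_pi_smallPart_le (μ : Fin N → Measure ℝ) [∀ i, IsProbabilityMeasure (μ i)]
    (hN : 1 ≤ N) {k : ℕ} (hk : 1 ≤ k) {p M m : ℝ} (hp : 0 < p) (hm : 0 ≤ m)
    (hMp : M ^ p = N / k)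
    (h : ∀ i, ∫⁻ u, ENNReal.ofReal (|u| ^ p) ∂(μ i) ≤ ENNReal.ofReal m) :
    ∫⁻ x, ENNReal.ofReal (((∑ i, if M < |x i| then 0 else |x i| ^ p) / N) ^ k) ∂(Measure.pi μ)
      ≤ ENNReal.ofReal (Real.exp (2 * m) ^ k) := by
  have hN0 : (0 : ℝ) < N := by exact_mod_cast hN
  have hk0 : (0 : ℝ) < k := by exact_mod_cast hk
  set τ : ℝ → ℝ := fun u => (k / N : ℝ) * (if M < |u| then 0 else |u| ^ p) with hτ
  have hτ0 : ∀ u, 0 ≤ τ u := fun u => by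
    simp only [hτ]; split_ifs <;> positivity
  have hτm : Measurable τ := by
    refine Measurable.const_mul (Measurable.ite ?_ measurable_const (by fun_prop)) _
    exact measurableSet_lt measurable_const (by fun_prop)
  have hτ1 : ∀ u, τ u ≤ 1 := fun u => by
    simp only [hτ]
    split_ifs with hu
    · simp
    · have : |u| ^ p ≤ N / k := by
        rw [← hMp]; exact Real.rpow_le_rpow (abs_nonneg _) (not_lt.mp hu) hp.le
      calc (k / N : ℝ) * |u| ^ p ≤ (k / N : ℝ) * (N / k) := by gcongr
        _ = 1 := by field_simp
  have hexp : ∀ u, Real.exp (τ u) ≤ 1 + 2 * (k / N : ℝ) * |u| ^ p := fun u => by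
    have h1 := Real.abs_exp_sub_one_le (x := τ u) (by rw [abs_of_nonneg (hτ0 u)]; exact hτ1 u)
    rw [abs_of_nonneg (hτ0 u)] at h1
    have h2 := le_abs_self (Real.exp (τ u) - 1)
    have h3 : τ u ≤ (k / N : ℝ) * |u| ^ p := by
      simp only [hτ]
      gcongr
      split_ifs
      · positivity
      · exact le_rfl
    linarith
  have hone : ∀ i, ∫⁻ u, ENNReal.ofReal (Real.exp (τ u)) ∂(μ i)
      ≤ ENNReal.ofReal (Real.exp (2 * m * (k / N))) := fun i =>
    calc _ ≤ ∫⁻ u, (1 + ENNReal.ofReal (2 * (k / N : ℝ) * |u| ^ p)) ∂(μ i) := by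
          refine lintegral_mono fun u => ?_
          rw [← ENNReal.ofReal_one, ← ENNReal.ofReal_add zero_le_one (by positivity)]
          exact ENNReal.ofReal_le_ofReal (hexp u)
      _ = 1 + ∫⁻ u, ENNReal.ofReal (2 * (k / N : ℝ) * |u| ^ p) ∂(μ i) := by
          rw [lintegral_add_left measurable_const]; simp
      _ ≤ 1 + ENNReal.ofReal (2 * (k / N : ℝ) * m) := by
          gcongr
          exact lintegral_ofReal_le_of_le_mul (by positivity) (h i) (fun u => le_rfl) le_rfl
      _ ≤ _ := by
          rw [← ENNReal.ofReal_one, ← ENNReal.ofReal_add zero_le_one (by positivity)]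
          refine ENNReal.ofReal_le_ofReal ?_
          have := Real.add_one_le_exp (2 * m * (k / N : ℝ))
          linarith
  have key := lintegral_pi_prod_le μ (Real.measurable_exp.comp hτm) (fun u => (Real.exp_pos _).le)
    (Real.exp_pos _).le hone
  have hpow : Real.exp (2 * m * (k / N)) ^ N = Real.exp (2 * m) ^ k := by
    rw [← Real.exp_nat_mul, ← Real.exp_nat_mul]
    congr 1; field_simp
  rw [hpow] at key
  refine (lintegral_mono fun x => ENNReal.ofReal_le_ofReal ?_).trans key
  have hT : (∑ i, if M < |x i| then 0 else |x i| ^ p) / N = (∑ i, τ (x i)) / k := by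
    simp only [hτ, ← Finset.mul_sum]; field_simp
  have hs0 : 0 ≤ ∑ i, τ (x i) := Finset.sum_nonneg fun i _ => hτ0 _
  simp only [Function.comp_apply]
  rw [hT, ← Real.exp_sum, div_pow]
  refine le_trans ?_ (Real.pow_div_factorial_le_exp _ hs0 k)
  gcongr
  exact_mod_cast Nat.factorial_le_pow k

/-- The elementary inequality behind the high order terms in `lintegral_one_add_pow_le`. -/
theorem div_rpow_mul_le_mul_exp {z β : ℝ} (hz : 0 ≤ z) (hβ1 : β ≤ 1) {l : ℕ} (hl : 1 ≤ l)
    (hβl : 1 ≤ β * l) : (z / l) ^ (β * l) ≤ z * Real.exp z := by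
  have hl0 : (0 : ℝ) < l := by exact_mod_cast hl
  have hl1 : (1 : ℝ) ≤ l := by exact_mod_cast hl
  have hzl : 0 ≤ z / l := by positivity
  rcases le_total (z / l) 1 with h | h
  · calc (z / l) ^ (β * l) ≤ (z / l) ^ (1 : ℝ) := by
          rcases hzl.eq_or_lt with h0 | h0
          · rw [← h0, Real.zero_rpow (by linarith), Real.zero_rpow one_ne_zero]
          · exact Real.rpow_le_rpow_of_exponent_ge h0 h hβl
      _ = z / l := Real.rpow_one _
      _ ≤ z := div_le_self hz hl1
      _ ≤ z * Real.exp z := le_mul_of_one_le_right hz (Real.one_le_exp hz)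
  · have hz1 : 1 ≤ z := by
      rw [one_le_div hl0] at h; linarith
    calc (z / l) ^ (β * l) ≤ (z / l) ^ (l : ℝ) :=
          Real.rpow_le_rpow_of_exponent_le h (by nlinarith)
      _ = z ^ l / l ^ l := by rw [Real.rpow_natCast, div_pow]
      _ ≤ z ^ l / l.factorial := by
          gcongr
          exact_mod_cast Nat.factorial_le_pow l
      _ ≤ Real.exp z := Real.pow_div_factorial_le_exp _ hz l
      _ ≤ z * Real.exp z := le_mul_of_one_le_left (Real.exp_pos _).le hz1

theorem one_add_mul_add_mul_exp_le {m z : ℝ} (hm : 0 ≤ m) (hz : 0 ≤ z) :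
    1 + (m * z + z * Real.exp z) ≤ Real.exp ((m + 2) * z) := by
  have h1 : 1 + m * z ≤ Real.exp (m * z) := by linarith [Real.add_one_le_exp (m * z)]
  have h2 : 1 + z * Real.exp z ≤ Real.exp (2 * z) := by
    have h3 := Real.add_one_le_exp z
    have h4 := Real.one_le_exp hz
    have h5 : Real.exp z * (1 + z) ≤ Real.exp z * Real.exp z := by gcongr; linarith
    rw [two_mul, Real.exp_add]
    linarith
  calc _ ≤ (1 + m * z) * (1 + z * Real.exp z) := by
        have : 0 ≤ m * z * (z * Real.exp z) := by positivity
        linarith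
    _ ≤ Real.exp (m * z) * Real.exp (2 * z) := by gcongr
    _ = _ := by rw [← Real.exp_add]; congr 1; ring

set_option maxHeartbeats 400000 in
/-- The moments of order `2 * k` of the truncated variables `|u| ^ a`, `|u| > M`. In the binomial
expansion, the terms of low order are controlled by the truncation and the moment of order `2 * r`,
those of high order by the subgaussian growth of the moments up to order `4 * k`. -/
theorem lintegral_one_add_pow_le (μ : Measure ℝ) [IsProbabilityMeasure μ] (hN : 1 ≤ N) {k : ℕ}
    (hk : 1 ≤ k) {a r δ L m : ℝ} (hL : 1 ≤ L) (ha1 : 1 < a) (ha2 : a < 2) (hδ : 2 * r * δ = 1)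
    (hδ0 : 0 < δ) (hβ : a * δ = 1 - a / 2) (hm0 : 0 ≤ m)
    (hm : ∫⁻ u, ENNReal.ofReal (|u| ^ (2 * r)) ∂μ ≤ ENNReal.ofReal m)
    (h : ∀ s : ℝ, 1 ≤ s → s ≤ 4 * k →
      ∫⁻ u, ENNReal.ofReal (|u| ^ s) ∂μ ≤ ENNReal.ofReal ((L * Real.sqrt s) ^ s)) :
    ∫⁻ u, ENNReal.ofReal ((1 + (if (N / k : ℝ) ^ δ < |u| then |u| ^ a else 0)
        / (8 * Real.exp 1 * L ^ 2 * k * (N / k : ℝ) ^ (a * δ))) ^ (2 * k)) ∂μ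
      ≤ ENNReal.ofReal (Real.exp ((m + 2) * (k / N))) := by
  have hN0 : (0 : ℝ) < N := by exact_mod_cast hN
  have hk0 : (0 : ℝ) < k := by exact_mod_cast hk
  set X : ℝ := N / k with hX
  have hX0 : 0 < X := by positivity
  set z : ℝ := k / N with hz
  have hz0 : 0 < z := by positivity
  have hzX : z = X⁻¹ := by rw [hz, hX, inv_div]
  -- with this constant, the terms of the expansion decay at least like `(1 / 2) ^ l`
  set c : ℝ := 8 * Real.exp 1 * L ^ 2 with hc
  have he : (1 : ℝ) ≤ Real.exp 1 := Real.one_le_exp zero_le_one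
  have hL2 : 1 ≤ L ^ 2 := one_le_pow₀ hL
  have hc8 : 4 ≤ c := by
    have : 1 ≤ Real.exp 1 * L ^ 2 := one_le_mul_of_one_le_of_one_le he hL2
    rw [hc]; linarith
  have hc0 : 0 < c := by linarith
  set t : ℝ := c * k * X ^ (a * δ) with ht
  have ht0 : 0 < t := by positivity
  set y : ℝ → ℝ := fun u => if X ^ δ < |u| then |u| ^ a else 0 with hy
  have hy0 : ∀ u, 0 ≤ y u := fun u => by simp only [hy]; split_ifs <;> positivity
  have hym : Measurable y :=
    Measurable.ite (measurableSet_lt measurable_const (by fun_prop)) (by fun_prop) measurable_const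
  have htpow : ∀ l : ℕ, t ^ l = c ^ l * k ^ l * X ^ (a * δ * l) := fun l => by
    rw [ht, mul_pow, mul_pow, Real.rpow_mul hX0.le (a * δ), Real.rpow_natCast]
  have hxabs : ∀ (u : ℝ) (l : ℕ), (|u| ^ a) ^ l = |u| ^ (a * l) := fun u l => by
    rw [Real.rpow_mul (abs_nonneg _), Real.rpow_natCast]
  set D : ℝ := m * z + z * Real.exp z with hD
  have hD0 : 0 ≤ D := by positivity
  have hterm : ∀ l : ℕ, 1 ≤ l → l ≤ 2 * k →
      ∫⁻ u, ENNReal.ofReal ((y u / t) ^ l * (2 * k).choose l) ∂μ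
        ≤ ENNReal.ofReal ((1 / 2) ^ l * D) := by
    intro l hl hlk
    have hl0 : (0 : ℝ) < l := by exact_mod_cast hl
    have hl1 : (1 : ℝ) ≤ l := by exact_mod_cast hl
    have hlk' : (l : ℝ) ≤ 2 * k := by exact_mod_cast hlk
    rcases le_or_gt (a * l) (2 * r) with hal | hal
    · have hch : ((2 * k).choose l : ℝ) ≤ (2 * k) ^ l := by
        exact_mod_cast Nat.choose_le_pow (2 * k) l
      refine lintegral_ofReal_le_of_le_mul
        (c := (t ^ l)⁻¹ * (2 * k) ^ l * X ^ (a * δ * l - 1)) (by positivity) hm (fun u => ?_) ?_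
      · have h1 : y u ^ l ≤ X ^ (a * δ * l - 1) * |u| ^ (2 * r) := by
          simp only [hy]
          split_ifs with hu
          · have hM : 0 < X ^ δ := by positivity
            have hu0 : 0 < |u| := hM.trans hu
            rw [hxabs, show a * l = (a * l - 2 * r) + 2 * r by ring, Real.rpow_add hu0]
            gcongr
            refine (Real.rpow_le_rpow_of_nonpos hM hu.le (by linarith)).trans (le_of_eq ?_)
            rw [← Real.rpow_mul hX0.le]
            congr 1; linear_combination -hδ
          · rw [zero_pow (by omega)]; positivity
        calc (y u / t) ^ l * (2 * k).choose l = (t ^ l)⁻¹ * (2 * k).choose l * y u ^ l := by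
              rw [div_pow]; ring
          _ ≤ (t ^ l)⁻¹ * (2 * k) ^ l * (X ^ (a * δ * l - 1) * |u| ^ (2 * r)) := by
              gcongr
          _ = _ := by ring
      · have h2 : (t ^ l)⁻¹ * (2 * k) ^ l * X ^ (a * δ * l - 1) = (2 / c) ^ l * z := by
          rw [htpow, Real.rpow_sub hX0, Real.rpow_one, hzX, div_pow,
            mul_pow 2 (k : ℝ)]
          field_simp
        rw [h2]
        have h3 : 2 / c ≤ 1 / 2 := by
          rw [div_le_div_iff₀ hc0 two_pos]; linarith
        calc (2 / c) ^ l * z * m ≤ (1 / 2) ^ l * z * m := by gcongr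
          _ ≤ (1 / 2) ^ l * D := by
            rw [hD, mul_assoc, mul_comm z m]
            gcongr
            exact le_add_of_nonneg_right (by positivity)
    · have hch : ((2 * k).choose l : ℝ) ≤ (2 * k) ^ l / l.factorial := by
        exact_mod_cast Nat.choose_le_pow_div (α := ℝ) l (2 * k)
      have hal1 : 1 ≤ a * l := by nlinarith
      have hmom := h (a * l) hal1 (by nlinarith)
      refine lintegral_ofReal_le_of_le_mul
        (c := (t ^ l)⁻¹ * ((2 * k) ^ l / l.factorial)) (by positivity) hmom (fun u => ?_) ?_
      · have h1 : y u ^ l ≤ |u| ^ (a * l) := by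
          simp only [hy]
          split_ifs with hu
          · rw [hxabs]
          · rw [zero_pow (by omega)]; positivity
        calc (y u / t) ^ l * (2 * k).choose l = (t ^ l)⁻¹ * (2 * k).choose l * y u ^ l := by
              rw [div_pow]; ring
          _ ≤ (t ^ l)⁻¹ * ((2 * k) ^ l / l.factorial) * |u| ^ (a * l) := by
              gcongr
      · have hβl : 1 ≤ a * δ * l := by nlinarith
        have hβ1 : a * δ ≤ 1 := by linarith
        have h4 := div_rpow_mul_le_mul_exp hz0.le hβ1 hl hβl
        have h5 : (L * Real.sqrt (a * l)) ^ (a * l)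
            ≤ (2 * L ^ 2) ^ l * ((l : ℝ) ^ l * ((l : ℝ) ^ (a * δ * l))⁻¹) := by
          have e1 : L ^ (a * l) ≤ (L ^ 2) ^ l := by
            rw [← pow_mul, ← Real.rpow_natCast]
            refine Real.rpow_le_rpow_of_exponent_le hL ?_
            push_cast; gcongr
          have e2 : Real.sqrt (a * l) ^ (a * l) = (a * l) ^ ((1 - a * δ) * l) := by
            rw [Real.sqrt_eq_rpow, ← Real.rpow_mul (by positivity)]
            congr 1; rw [hβ]; ring
          have e3 : (a * l) ^ ((1 - a * δ) * l) ≤ (2 : ℝ) ^ l * (l : ℝ) ^ ((1 - a * δ) * l) := by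
            rw [Real.mul_rpow (by linarith) hl0.le]
            gcongr
            calc a ^ ((1 - a * δ) * l) ≤ 2 ^ ((1 - a * δ) * l) := by
                  refine Real.rpow_le_rpow (by linarith) ha2.le ?_
                  exact mul_nonneg (by linarith) hl0.le
              _ ≤ 2 ^ (l : ℝ) := by
                  refine Real.rpow_le_rpow_of_exponent_le one_le_two ?_
                  have : 0 < a * δ := by positivity
                  nlinarith
              _ = 2 ^ l := Real.rpow_natCast _ _
          have e4 : (l : ℝ) ^ ((1 - a * δ) * l) = (l : ℝ) ^ l * ((l : ℝ) ^ (a * δ * l))⁻¹ := by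
            rw [← Real.rpow_neg hl0.le, ← Real.rpow_natCast, ← Real.rpow_add hl0]
            congr 1; ring
          rw [Real.mul_rpow (by linarith) (Real.sqrt_nonneg _), e2]
          calc _ ≤ (L ^ 2) ^ l * ((2 : ℝ) ^ l * (l : ℝ) ^ ((1 - a * δ) * l)) := by gcongr
            _ = _ := by rw [e4, mul_pow]; ring
        have h6 : (l : ℝ) ^ l / l.factorial ≤ Real.exp 1 ^ l := by
          rw [← Real.exp_nat_mul, mul_one]
          exact Real.pow_div_factorial_le_exp _ hl0.le l
        have h7 : (z / l) ^ (a * δ * l) = (X ^ (a * δ * l))⁻¹ * ((l : ℝ) ^ (a * δ * l))⁻¹ := by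
          rw [Real.div_rpow hz0.le hl0.le, hzX, Real.inv_rpow hX0.le]; ring
        calc _ ≤ (t ^ l)⁻¹ * ((2 * k) ^ l / l.factorial) *
              ((2 * L ^ 2) ^ l * ((l : ℝ) ^ l * ((l : ℝ) ^ (a * δ * l))⁻¹)) := by gcongr
          _ = (4 * L ^ 2 / c) ^ l * ((l : ℝ) ^ l / l.factorial) * (z / l) ^ (a * δ * l) := by
              rw [h7, htpow, div_pow, show 4 * L ^ 2 = 2 * (2 * L ^ 2) by ring, mul_pow 2 (2 * L ^ 2),
                mul_pow 2 (k : ℝ)]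
              field_simp
          _ ≤ (4 * L ^ 2 / c) ^ l * Real.exp 1 ^ l * (z * Real.exp z) := by gcongr
          _ = (1 / 2) ^ l * (z * Real.exp z) := by
              rw [← mul_pow, hc]
              congr 2
              field_simp
              norm_num
          _ ≤ (1 / 2) ^ l * D := by
              rw [hD]
              gcongr
              exact le_add_of_nonneg_left (by positivity)
  have hexpand : ∀ u, ENNReal.ofReal ((1 + y u / t) ^ (2 * k))
      = (∑ l ∈ Finset.range (2 * k),
          ENNReal.ofReal ((y u / t) ^ (l + 1) * (2 * k).choose (l + 1))) + 1 := by
    intro u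
    have hyt : 0 ≤ y u / t := div_nonneg (hy0 u) ht0.le
    rw [← ENNReal.ofReal_sum_of_nonneg fun l _ => by positivity, ← ENNReal.ofReal_one,
      ← ENNReal.ofReal_add (Finset.sum_nonneg fun l _ => by positivity) zero_le_one,
      add_comm 1, add_pow, Finset.sum_range_succ']
    simp
  calc _ = ∫⁻ u, ((∑ l ∈ Finset.range (2 * k),
          ENNReal.ofReal ((y u / t) ^ (l + 1) * (2 * k).choose (l + 1))) + 1) ∂μ :=
        lintegral_congr hexpand
    _ = (∑ l ∈ Finset.range (2 * k),
          ∫⁻ u, ENNReal.ofReal ((y u / t) ^ (l + 1) * (2 * k).choose (l + 1)) ∂μ) + 1 := by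
        rw [lintegral_add_right _ measurable_const, lintegral_finsetSum _ fun l _ => by fun_prop]
        simp
    _ ≤ (∑ l ∈ Finset.range (2 * k), ENNReal.ofReal ((1 / 2) ^ (l + 1) * D)) + 1 := by
        refine add_le_add_left (Finset.sum_le_sum fun l hl => ?_) 1
        exact hterm (l + 1) (by omega) (by have := Finset.mem_range.mp hl; omega)
    _ = ENNReal.ofReal ((∑ l ∈ Finset.range (2 * k), (1 / 2) ^ (l + 1) * D) + 1) := by
        rw [← ENNReal.ofReal_sum_of_nonneg fun l _ => by positivity, ← ENNReal.ofReal_one,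
          ← ENNReal.ofReal_add (Finset.sum_nonneg fun l _ => by positivity) zero_le_one]
    _ ≤ _ := by
        refine ENNReal.ofReal_le_ofReal ?_
        have h1 : ∑ l ∈ Finset.range (2 * k), (1 / 2 : ℝ) ^ (l + 1) * D ≤ D := by
          simp only [pow_succ, ← Finset.sum_mul]
          have := sum_geometric_two_le (2 * k)
          nlinarith
        have h2 := one_add_mul_add_mul_exp_le hm0 hz0.le
        linarith

end PowerSums

section MomentBound

variable {N : ℕ}

theorem one_add_sum_le_prod_one_add_of_nonneg {ι : Type*} (s : Finset ι) {f : ι → ℝ}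
    (hf : ∀ i, 0 ≤ f i) : 1 + ∑ i ∈ s, f i ≤ ∏ i ∈ s, (1 + f i) := by
  classical
  induction s using Finset.induction_on with
  | empty => simp
  | insert j s hj ih =>
    rw [Finset.sum_insert hj, Finset.prod_insert hj]
    have h1 : 0 ≤ ∑ i ∈ s, f i := Finset.sum_nonneg fun i _ => hf i
    have := mul_le_mul_of_nonneg_left ih (by linarith [hf j] : 0 ≤ 1 + f j)
    nlinarith [mul_nonneg (hf j) h1]

/-- The moment of order `2 * k` of the sum of the truncated variables, via Latała's trick
`∑ y_i / t ≤ ∏ (1 + y_i / t)`. -/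
theorem lintegral_pi_bigPart_le (μ : Fin N → Measure ℝ) [∀ i, IsProbabilityMeasure (μ i)]
    (hN : 1 ≤ N) {k : ℕ} (hk : 1 ≤ k) {a r δ L m : ℝ} (hL : 1 ≤ L) (ha1 : 1 < a) (ha2 : a < 2)
    (hδ : 2 * r * δ = 1) (hδ0 : 0 < δ) (hβ : a * δ = 1 - a / 2) (hm0 : 0 ≤ m)
    (hm : ∀ i, ∫⁻ u, ENNReal.ofReal (|u| ^ (2 * r)) ∂(μ i) ≤ ENNReal.ofReal m)
    (h : ∀ i, ∀ s : ℝ, 1 ≤ s → s ≤ 4 * k →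
      ∫⁻ u, ENNReal.ofReal (|u| ^ s) ∂(μ i) ≤ ENNReal.ofReal ((L * Real.sqrt s) ^ s)) :
    ∫⁻ x, ENNReal.ofReal (((∑ i, if (N / k : ℝ) ^ δ < |x i| then |x i| ^ a else 0)
        / (8 * Real.exp 1 * L ^ 2 * k * (N / k : ℝ) ^ (a * δ))) ^ (2 * k)) ∂(Measure.pi μ)
      ≤ ENNReal.ofReal (Real.exp (m + 2) ^ k) := by
  have hN0 : (0 : ℝ) < N := by exact_mod_cast hN
  set t : ℝ := 8 * Real.exp 1 * L ^ 2 * k * (N / k : ℝ) ^ (a * δ) with ht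
  have ht0 : 0 ≤ t := by positivity
  have hy : ∀ u : ℝ, 0 ≤ if (N / k : ℝ) ^ δ < |u| then |u| ^ a else 0 := fun u => by
    split_ifs <;> positivity
  have hym : Measurable fun u : ℝ => if (N / k : ℝ) ^ δ < |u| then |u| ^ a else 0 :=
    Measurable.ite (measurableSet_lt measurable_const (by fun_prop)) (by fun_prop) measurable_const
  have key := lintegral_pi_prod_le μ (f := fun u => (1 + (if (N / k : ℝ) ^ δ < |u| then |u| ^ a
    else 0) / t) ^ (2 * k)) (by fun_prop) (fun u => by rw [pow_mul]; positivity)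
    (Real.exp_pos _).le
    (fun i => lintegral_one_add_pow_le (μ i) hN hk hL ha1 ha2 hδ hδ0 hβ hm0 (hm i) (h i))
  have hpow : Real.exp ((m + 2) * (k / N)) ^ N = Real.exp (m + 2) ^ k := by
    rw [← Real.exp_nat_mul, ← Real.exp_nat_mul]
    congr 1; field_simp
  rw [hpow] at key
  refine (lintegral_mono fun x => ENNReal.ofReal_le_ofReal ?_).trans key
  rw [Finset.prod_pow, Finset.sum_div]
  have h0 : ∀ i, 0 ≤ (if (N / k : ℝ) ^ δ < |x i| then |x i| ^ a else 0) / t :=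
    fun i => div_nonneg (hy _) ht0
  refine pow_le_pow_left₀ (Finset.sum_nonneg fun i _ => h0 i) ?_ _
  linarith [one_add_sum_le_prod_one_add_of_nonneg Finset.univ h0]

theorem rpow_pow_le_one_add_pow {T p : ℝ} (hT : 0 ≤ T) (hp : 0 ≤ p) {j n : ℕ} (h : p * j ≤ n) :
    (T ^ p) ^ j ≤ 1 + T ^ n := by
  rw [← Real.rpow_natCast, ← Real.rpow_mul hT, ← Real.rpow_natCast T n]
  rcases le_total T 1 with h1 | h1
  · have := Real.rpow_le_one hT h1 (by positivity : 0 ≤ p * j)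
    have : 0 ≤ T ^ (n : ℝ) := by positivity
    linarith
  · linarith [Real.rpow_le_rpow_of_exponent_le h1 h]

theorem lintegral_ofReal_one_add_le {α : Type*} [MeasurableSpace α] {μ : Measure α}
    [IsProbabilityMeasure μ] {f : α → ℝ} (hf : ∀ u, 0 ≤ f u) {b : ℝ} (hb : 0 ≤ b)
    (h : ∫⁻ u, ENNReal.ofReal (f u) ∂μ ≤ ENNReal.ofReal b) :
    ∫⁻ u, ENNReal.ofReal (1 + f u) ∂μ ≤ ENNReal.ofReal (1 + b) := by
  simp only [fun u => ENNReal.ofReal_add zero_le_one (hf u), ENNReal.ofReal_add zero_le_one hb,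
    ENNReal.ofReal_one]
  rw [lintegral_add_left measurable_const]
  simpa using h

theorem lintegral_ofReal_const_mul_le {α : Type*} [MeasurableSpace α] {μ : Measure α}
    {f : α → ℝ} {b c : ℝ} (hc : 0 ≤ c)
    (h : ∫⁻ u, ENNReal.ofReal (f u) ∂μ ≤ ENNReal.ofReal b) :
    ∫⁻ u, ENNReal.ofReal (c * f u) ∂μ ≤ ENNReal.ofReal (c * b) := by
  simp only [ENNReal.ofReal_mul hc]
  rw [lintegral_const_mul' _ _ ENNReal.ofReal_ne_top]
  gcongr

theorem lintegral_pi_empirical_le (μ : Fin N → Measure ℝ) [∀ i, IsProbabilityMeasure (μ i)]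
    (hN : 1 ≤ N) {g : ℝ → ℝ} (hg : Measurable g) (hg0 : ∀ u, 0 ≤ g u) {m : ℝ}
    (h : ∀ i, ∫⁻ u, ENNReal.ofReal (g u) ∂(μ i) ≤ ENNReal.ofReal m) :
    ∫⁻ x, ENNReal.ofReal ((∑ i, g (x i)) / N) ∂(Measure.pi μ) ≤ ENNReal.ofReal m := by
  have hN0 : (0 : ℝ) < N := by exact_mod_cast hN
  have h1 : ∫⁻ x, ENNReal.ofReal (∑ i, g (x i)) ∂(Measure.pi μ) ≤ ENNReal.ofReal (N * m) := by
    simp only [ENNReal.ofReal_sum_of_nonneg fun i _ => hg0 _]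
    rw [lintegral_finsetSum _ fun i _ => by fun_prop]
    calc _ ≤ ∑ _i : Fin N, ENNReal.ofReal m := by
          refine Finset.sum_le_sum fun i _ => ?_
          rw [← lintegral_map' (f := fun u => ENNReal.ofReal (g u)) (g := fun x : Fin N → ℝ => x i)
            (by fun_prop) (measurable_pi_apply i).aemeasurable, (measurePreserving_eval μ i).map_eq]
          exact h i
      _ = _ := by rw [ENNReal.ofReal_mul hN0.le]; simp
  have := lintegral_ofReal_const_mul_le (inv_nonneg.mpr hN0.le) h1
  rw [inv_mul_cancel_left₀ hN0.ne'] at this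
  simpa only [div_eq_inv_mul] using this

/-- Even moments of the normalized sums `N^{-1/2} ∑ ε_i ξ_i x_i`, where the `x_i` are independent
with subgaussian growth of the moments up to order `p`. After division by the empirical `L_q` norm
of `ξ`, the moments up to order `≈ p` grow as those of a gaussian variable, *uniformly in `ξ`*: the
average over the signs is bounded by a function `H` of `x` alone. -/
theorem exists_signAvg_moment_bound {q L : ℝ} (hq : 2 < q) (hL : 1 ≤ L) :
    ∃ C : ℝ, 0 < C ∧ ∀ N : ℕ, 1 ≤ N → ∀ k : ℕ, 1 ≤ k → ∃ H : (Fin N → ℝ) → ℝ,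
      Measurable H ∧ (∀ x, 0 ≤ H x) ∧
      (∀ ξ x : Fin N → ℝ,
        signAvg (fun s => ((Real.sqrt N)⁻¹ * ∑ i, boolSign (s i) * (ξ i * x i)) ^ (2 * k))
          ≤ (((∑ i, |ξ i| ^ q) / N) ^ (1 / q)) ^ (2 * k) * H x) ∧
      ∀ (μ : Fin N → Measure ℝ) [∀ i, IsProbabilityMeasure (μ i)] (p : ℝ),
        2 * q / (q - 2) ≤ p → (k ≤ q / (q - 2) ∨ 4 * k ≤ p) →
        (∀ i, ∀ s : ℝ, 1 ≤ s → s ≤ p →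
          ∫⁻ u, ENNReal.ofReal (|u| ^ s) ∂(μ i) ≤ ENNReal.ofReal ((L * Real.sqrt s) ^ s)) →
        ∫⁻ x, ENNReal.ofReal (H x) ∂(Measure.pi μ) ≤ ENNReal.ofReal ((C * k) ^ k) := by
  have hq2 : 0 < q - 2 := by linarith
  have hq1 : 0 < q - 1 := by linarith
  have hq0 : 0 < q := by linarith
  obtain ⟨r, hr⟩ : ∃ r, r = q / (q - 2) := ⟨_, rfl⟩
  obtain ⟨a, ha⟩ : ∃ a, a = q / (q - 1) := ⟨_, rfl⟩
  obtain ⟨δ, hδ⟩ : ∃ δ, δ = 1 / 2 - 1 / q := ⟨_, rfl⟩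
  have hqa : q.HolderConjugate a := ha ▸ Real.HolderConjugate.conjExponent (by linarith)
  have hqr : (q / 2).HolderConjugate r := by
    have := Real.HolderConjugate.conjExponent (p := q / 2) (by linarith)
    convert this using 1
    rw [hr, Real.conjExponent]; field_simp
  have ha1 : 1 < a := hqa.symm.lt
  have hr1 : 1 < r := hqr.symm.lt
  have ha2 : a < 2 := by rw [ha, div_lt_iff₀ hq1]; linarith
  have hδ0 : 0 < δ := by
    rw [hδ, sub_pos]; exact one_div_lt_one_div_of_lt two_pos hq
  have hrδ : 2 * r * δ = 1 := by rw [hr, hδ]; field_simp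
  have haδ : a * δ = 1 - a / 2 := by rw [ha, hδ]; field_simp; ring
  have h2r : 2 * q / (q - 2) = 2 * r := by rw [hr]; ring
  rw [h2r, ← hr]
  set m : ℝ := (L * Real.sqrt (2 * r)) ^ (2 * r) with hm
  have hm0 : 0 ≤ m := by positivity
  set c : ℝ := 8 * Real.exp 1 * L ^ 2 with hc
  have hc1 : 1 ≤ c := by
    have := one_le_mul_of_one_le_of_one_le (Real.one_le_exp zero_le_one)
      (one_le_pow₀ hL : 1 ≤ L ^ 2)
    rw [hc]; linarith
  set u₁ : ℝ := c ^ 2 * Real.exp (m + 2) with hu₁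
  set u₂ : ℝ := 2 * Real.exp 1 * Real.exp (2 * m) with hu₂
  have hu₁0 : 0 < u₁ := by positivity
  have hu₂0 : 0 < u₂ := by positivity
  refine ⟨8 * (u₁ + u₂), by positivity, fun N hN k hk => ?_⟩
  have hN0 : (0 : ℝ) < N := by exact_mod_cast hN
  have hk0 : (0 : ℝ) < k := by exact_mod_cast hk
  have hk1 : (1 : ℝ) ≤ k := by exact_mod_cast hk
  have hone : ∀ x : ℝ, 0 ≤ x → 1 + Real.exp x ^ k ≤ 2 * Real.exp x ^ k := fun x hx => by
    linarith [one_le_pow₀ (n := k) (Real.one_le_exp hx)]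
  -- for small `k` no coordinate counts as large, and the moment of order `2 * r` suffices
  rcases le_or_gt (k : ℝ) r with hkr | hkr
  · refine ⟨fun x => 4 ^ k * ((2 * Real.exp 1 * k) ^ k *
      (((∑ i, |x i| ^ (2 * r)) / N) ^ (1 / r)) ^ k), by fun_prop, fun x => by positivity,
      fun ξ x => ?_, fun μ _ p hp _ h => ?_⟩
    · have := signAvg_pow_le_of_split hN hqa hqr hδ hk ξ x ∅
      have h0 : (2 * k) ≠ 0 := by omega
      have h1 : a⁻¹ ≠ 0 := by positivity
      simpa [Real.zero_rpow h1, h0] using this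
    · have hT := lintegral_pi_empirical_le μ hN (g := fun u => |u| ^ (2 * r)) (by fun_prop)
        (fun u => by positivity) fun i => h i (2 * r) (by linarith) hp
      have hT' := lintegral_ofReal_one_add_le (fun x => by positivity) hm0 hT
      have := lintegral_ofReal_const_mul_le
        (by positivity : 0 ≤ (4 : ℝ) ^ k * (2 * Real.exp 1 * k) ^ k) hT'
      refine (lintegral_mono fun x => ENNReal.ofReal_le_ofReal ?_).trans
        (this.trans (ENNReal.ofReal_le_ofReal ?_))
      · have := rpow_pow_le_one_add_pow (T := (∑ i, |x i| ^ (2 * r)) / N) (p := 1 / r) (j := k)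
          (n := 1) (by positivity) (by positivity)
          (by rw [one_div_mul_eq_div, Nat.cast_one, div_le_one (by linarith)]; exact hkr)
        rw [pow_one] at this
        rw [← mul_assoc]
        gcongr
      · have h1 : 1 + m ≤ 2 ^ k * Real.exp (2 * m) ^ k := by
          have h3 := Real.add_one_le_exp (2 * m)
          have h4 : Real.exp (2 * m) ≤ Real.exp (2 * m) ^ k :=
            le_self_pow₀ (Real.one_le_exp (by linarith)) (by omega)
          have h5 : (1 : ℝ) ≤ 2 ^ k := one_le_pow₀ one_le_two
          calc 1 + m ≤ Real.exp (2 * m) ^ k := by linarith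
            _ ≤ _ := le_mul_of_one_le_left (by positivity) h5
        calc _ ≤ (4 : ℝ) ^ k * (2 * Real.exp 1 * k) ^ k * (2 ^ k * Real.exp (2 * m) ^ k) := by
              gcongr
          _ = (8 * u₂ * k) ^ k := by
              rw [← mul_pow, ← mul_pow, ← mul_pow, hu₂]; ring
          _ ≤ _ := by gcongr; linarith
  · have hM : ((N / k : ℝ) ^ δ) ^ (2 * r) = N / k := by
      rw [← Real.rpow_mul (by positivity), show δ * (2 * r) = 1 by linarith, Real.rpow_one]
    set M : ℝ := (N / k : ℝ) ^ δ with hMdef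
    set t : ℝ := c * k * (N / k : ℝ) ^ (a * δ) with ht
    have ht0 : 0 < t := by positivity
    set S : (Fin N → ℝ) → ℝ := fun x => ∑ i, if M < |x i| then |x i| ^ a else 0 with hS
    set T : (Fin N → ℝ) → ℝ := fun x =>
      (∑ i, if M < |x i| then 0 else |x i| ^ (2 * r)) / N with hT
    have hS0 : ∀ x, 0 ≤ S x := fun x => Finset.sum_nonneg fun i _ => by
      split_ifs <;> positivity
    have hT0 : ∀ x, 0 ≤ T x := fun x => by
      refine div_nonneg (Finset.sum_nonneg fun i _ => ?_) hN0.le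
      split_ifs <;> positivity
    have hset : ∀ i : Fin N, MeasurableSet {x : Fin N → ℝ | M < |x i|} := fun i =>
      measurableSet_lt measurable_const (measurable_pi_apply i).abs
    have hSm : Measurable S := Finset.measurable_sum _ fun i _ =>
      Measurable.ite (hset i) (by fun_prop) measurable_const
    have hTm : Measurable T := (Finset.measurable_sum _ fun i _ =>
      Measurable.ite (hset i) measurable_const (by fun_prop)).div_const _
    refine ⟨fun x => 4 ^ k * (((N : ℝ) ^ (-δ) * S x ^ (1 / a)) ^ (2 * k)
      + (2 * Real.exp 1 * k) ^ k * (T x ^ (1 / r)) ^ k), by fun_prop, fun x => ?_,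
      fun ξ x => ?_, fun μ _ p hp hkp h => ?_⟩
    · have := hS0 x
      have := hT0 x
      positivity
    · have := signAvg_pow_le_of_split hN hqa hqr hδ hk ξ x
        (Finset.univ.filter fun i => M < |x i|)
      rw [Finset.compl_filter, Finset.sum_filter, Finset.sum_filter] at this
      simpa only [ite_not] using this
    · have hmi : ∀ i, ∫⁻ u, ENNReal.ofReal (|u| ^ (2 * r)) ∂(μ i) ≤ ENNReal.ofReal m :=
        fun i => h i (2 * r) (by linarith) hp
      have h4k : 4 * (k : ℝ) ≤ p := hkp.resolve_left (not_le.mpr hkr)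
      have hSint := lintegral_pi_bigPart_le μ hN hk hL ha1 ha2 hrδ hδ0 haδ hm0 hmi
        fun i s hs1 hs2 => h i s hs1 (hs2.trans h4k)
      have hTint := lintegral_pi_smallPart_le μ hN hk (by linarith : 0 < 2 * r) hm0 hM hmi
      have hS1 := lintegral_ofReal_const_mul_le (by positivity : 0 ≤ (4 : ℝ) ^ k * (c ^ 2 * k) ^ k)
        (lintegral_ofReal_one_add_le (fun x => by rw [pow_mul]; positivity) (by positivity) hSint)
      have hT1 := lintegral_ofReal_const_mul_le
        (by positivity : 0 ≤ (4 : ℝ) ^ k * (2 * Real.exp 1 * k) ^ k)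
        (lintegral_ofReal_one_add_le (fun x => pow_nonneg (hT0 x) k) (by positivity) hTint)
      -- `N^{-δ} t^{1/a} = c^{1/a} √k`, because `1/a - δ = 1/2`
      have hscale : ((N : ℝ) ^ (-δ) * t ^ (1 / a)) ^ 2 ≤ c ^ 2 * k := by
        have e1 : (N : ℝ) ^ (-δ) * t ^ (1 / a) = c ^ (1 / a) * Real.sqrt k := by
          have ea : 1 / a - δ = 1 / 2 := by
            field_simp
            linear_combination -2 * haδ
          rw [ht, Real.mul_rpow (by positivity) (by positivity),
            Real.mul_rpow (by positivity) (by positivity),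
            ← Real.rpow_mul (by positivity), show a * δ * (1 / a) = δ by field_simp,
            Real.div_rpow hN0.le hk0.le, Real.sqrt_eq_rpow, ← ea, Real.rpow_sub hk0,
            Real.rpow_neg hN0.le]
          field_simp
        rw [e1, mul_pow, Real.sq_sqrt hk0.le]
        gcongr
        calc c ^ (1 / a) ≤ c ^ (1 : ℝ) := by
              refine Real.rpow_le_rpow_of_exponent_le hc1 ?_
              rw [div_le_one (by linarith)]; exact ha1.le
          _ = c := Real.rpow_one c
      have hbound : ∀ x, 4 ^ k * (((N : ℝ) ^ (-δ) * S x ^ (1 / a)) ^ (2 * k)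
          + (2 * Real.exp 1 * k) ^ k * (T x ^ (1 / r)) ^ k)
          ≤ 4 ^ k * (c ^ 2 * k) ^ k * (1 + (S x / t) ^ (2 * k))
            + 4 ^ k * (2 * Real.exp 1 * k) ^ k * (1 + T x ^ k) := by
        intro x
        have b1 : ((S x / t) ^ (1 / a)) ^ (2 * k) ≤ 1 + (S x / t) ^ (2 * k) := by
          refine rpow_pow_le_one_add_pow (div_nonneg (hS0 x) ht0.le) (by positivity) ?_
          rw [one_div_mul_eq_div]
          exact div_le_self (by positivity) ha1.le
        have b2 : (T x ^ (1 / r)) ^ k ≤ 1 + T x ^ k := by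
          refine rpow_pow_le_one_add_pow (hT0 x) (by positivity) ?_
          rw [one_div_mul_eq_div]
          exact div_le_self (by positivity) hr1.le
        have b3 : ((N : ℝ) ^ (-δ) * S x ^ (1 / a)) ^ (2 * k)
            = (((N : ℝ) ^ (-δ) * t ^ (1 / a)) ^ 2) ^ k * ((S x / t) ^ (1 / a)) ^ (2 * k) := by
          rw [← pow_mul, ← mul_pow, Real.div_rpow (hS0 x) ht0.le]
          congr 1; field_simp
        have b4 : 0 ≤ ((S x / t) ^ (1 / a)) ^ (2 * k) := by rw [pow_mul]; positivity
        rw [b3, mul_add, ← mul_assoc, ← mul_assoc]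
        gcongr
      calc _ ≤ ∫⁻ x, (ENNReal.ofReal (4 ^ k * (c ^ 2 * k) ^ k * (1 + (S x / t) ^ (2 * k)))
            + ENNReal.ofReal (4 ^ k * (2 * Real.exp 1 * k) ^ k * (1 + T x ^ k)))
            ∂(Measure.pi μ) := by
            refine lintegral_mono fun x => ?_
            exact (ENNReal.ofReal_le_ofReal (hbound x)).trans ENNReal.ofReal_add_le
        _ ≤ ENNReal.ofReal (4 ^ k * (c ^ 2 * k) ^ k * (1 + Real.exp (m + 2) ^ k)) +
            ENNReal.ofReal (4 ^ k * (2 * Real.exp 1 * k) ^ k * (1 + Real.exp (2 * m) ^ k)) := by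
            rw [lintegral_add_left (by fun_prop)]
            exact add_le_add hS1 hT1
        _ ≤ _ := by
            rw [← ENNReal.ofReal_add (by positivity) (by positivity)]
            refine ENNReal.ofReal_le_ofReal ?_
            have h2 : (2 : ℝ) ≤ 2 ^ k := le_self_pow₀ one_le_two (by omega)
            calc _ ≤ 4 ^ k * (c ^ 2 * k) ^ k * (2 * Real.exp (m + 2) ^ k)
                  + 4 ^ k * (2 * Real.exp 1 * k) ^ k * (2 * Real.exp (2 * m) ^ k) := by
                  gcongr
                  · exact hone _ (by linarith)
                  · exact hone _ (by linarith)
              _ = 2 * (4 * k) ^ k * (u₁ ^ k + u₂ ^ k) := by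
                  rw [hu₁, hu₂]; simp only [mul_pow]; ring
              _ ≤ 2 ^ k * (4 * k) ^ k * (u₁ + u₂) ^ k := by
                  gcongr
                  exact pow_add_pow_le hu₁0.le hu₂0.le (by omega)
              _ = _ := by rw [← mul_pow, ← mul_pow]; ring

end MomentBound

/-! ### The gaussian side -/

section Gaussian

variable {n : ℕ}

theorem lt_sum_indicator_of_le_decRearr (x : EuclideanSpace ℝ (Fin n)) (i : Fin n) (t : ℝ)
    (h : t ≤ decRearr x i) : ((i : ℕ) : ℝ) < ∑ j, if t ≤ |x j| then (1 : ℝ) else 0 := by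
  rw [← sum_comp_decRearr x fun u => if t ≤ u then (1 : ℝ) else 0]
  calc ((i : ℕ) : ℝ) < ∑ l, if l ∈ Finset.Iic i then (1 : ℝ) else 0 := by
        rw [Finset.sum_ite_mem]
        simp [Fin.card_Iic]
    _ ≤ _ := by
        refine Finset.sum_le_sum fun l _ => ?_
        by_cases hl : l ≤ i
        · have := decRearr_antitone x hl
          simp [hl, h.trans this]
        · simp only [Finset.mem_Iic, hl, if_false]
          split_ifs <;> norm_num

theorem measurable_decRearr (i : Fin n) :
    Measurable fun x : EuclideanSpace ℝ (Fin n) => decRearr x i := by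
  refine measurable_of_Ici fun t => ?_
  have : (fun x : EuclideanSpace ℝ (Fin n) => decRearr x i) ⁻¹' Set.Ici t
      = {x | ((i : ℕ) : ℝ) < ∑ j, if t ≤ |x j| then (1 : ℝ) else 0} := by
    ext x
    exact ⟨lt_sum_indicator_of_le_decRearr x i t, le_decRearr_of_lt_sum_indicator x i t⟩
  rw [this]
  refine measurableSet_lt measurable_const (Finset.measurable_sum _ fun j _ => ?_)
  exact Measurable.ite (measurableSet_le measurable_const (by fun_prop)) measurable_const
    measurable_const

/-- A lower bound for the gaussian tail, from the density on `[t, t + 1]`. -/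
theorem exp_neg_le_gaussianReal_le_abs {t : ℝ} (ht : 0 ≤ t) :
    Real.exp (-2 - t ^ 2) ≤ (gaussianReal 0 1).real {u | t ≤ |u|} := by
  have hpdf : ∀ u ∈ Set.Icc t (t + 1),
      ENNReal.ofReal (Real.exp (-2 - t ^ 2)) ≤ gaussianPDF 0 1 u := by
    intro u hu
    refine ENNReal.ofReal_le_ofReal ?_
    rw [gaussianPDFReal]
    have h1 : Real.exp (-1) ≤ (Real.sqrt (2 * Real.pi * (1 : NNReal)))⁻¹ := by
      rw [Real.exp_neg]
      refine inv_anti₀ (by positivity) ?_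
      rw [Real.sqrt_le_left (Real.exp_pos _).le]
      have h2 := Real.exp_one_gt_d9
      have h3 := Real.pi_lt_d2
      simp only [NNReal.coe_one, mul_one]
      nlinarith
    have h4 : Real.exp (-1 - t ^ 2) ≤ Real.exp (-(u - 0) ^ 2 / (2 * (1 : NNReal))) := by
      refine Real.exp_le_exp.mpr ?_
      simp only [NNReal.coe_one, mul_one, sub_zero]
      have h5 : u ^ 2 ≤ (t + 1) ^ 2 := pow_le_pow_left₀ (ht.trans hu.1) hu.2 2
      nlinarith [sq_nonneg (t - 1)]
    calc Real.exp (-2 - t ^ 2) = Real.exp (-1) * Real.exp (-1 - t ^ 2) := by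
          rw [← Real.exp_add]; congr 1; ring
      _ ≤ _ := by gcongr
  have hsub : Set.Icc t (t + 1) ⊆ {u | t ≤ |u|} := fun u hu => hu.1.trans (le_abs_self u)
  have key : ENNReal.ofReal (Real.exp (-2 - t ^ 2)) ≤ gaussianReal 0 1 {u | t ≤ |u|} :=
    calc ENNReal.ofReal (Real.exp (-2 - t ^ 2))
        = ∫⁻ _ in Set.Icc t (t + 1), ENNReal.ofReal (Real.exp (-2 - t ^ 2)) := by simp
      _ ≤ ∫⁻ u in Set.Icc t (t + 1), gaussianPDF 0 1 u :=
          setLIntegral_mono' measurableSet_Icc hpdf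
      _ = gaussianReal 0 1 (Set.Icc t (t + 1)) := by
          rw [gaussianReal_apply _ one_ne_zero]
      _ ≤ _ := measure_mono hsub
  exact (ENNReal.ofReal_le_iff_le_toReal (measure_ne_top _ _)).mp key

/-- By Chebyshev's inequality for the number of coordinates of modulus at least `t`, the level `t`
is exceeded by `G^*_i` with probability at least `1 / 2` as soon as the expected number of such
coordinates is at least `8 (i + 1)`. -/
theorem half_le_stdGaussian_le_decRearr (i : Fin n) {t : ℝ}
    (h : 8 * ((i : ℕ) + 1 : ℝ) ≤ n * (gaussianReal 0 1).real {u | t ≤ |u|}) :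
    1 / 2 ≤ (stdGaussian (EuclideanSpace ℝ (Fin n))).real {x | t ≤ decRearr x i} := by
  set p := (gaussianReal 0 1).real {u | t ≤ |u|} with hp
  set f : ℝ → ℝ := {u | t ≤ |u|}.indicator 1 with hf
  have hset : MeasurableSet {u : ℝ | t ≤ |u|} := measurableSet_le measurable_const (by fun_prop)
  have hfm : Measurable f := measurable_const.indicator hset
  have hfb : ∀ u, ‖f u‖ ≤ 1 := fun u => by
    by_cases hu : t ≤ |u| <;> simp [hf, hu]
  have hf2 : MemLp f 2 (gaussianReal 0 1) :=
    MemLp.of_bound hfm.aestronglyMeasurable 1 (Filter.Eventually.of_forall hfb)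
  have hEf : ∫ u, f u ∂(gaussianReal 0 1) = p := integral_indicator_one hset
  have hVf : Var[f; gaussianReal 0 1] ≤ p := by
    refine (variance_le_expectation_sq hfm.aestronglyMeasurable).trans (le_of_eq ?_)
    rw [← hEf]
    refine integral_congr_ae (Filter.Eventually.of_forall fun u => ?_)
    by_cases hu : t ≤ |u| <;> simp [hf, hu]
  set π := Measure.pi fun _ : Fin n => gaussianReal 0 1 with hπ
  set B : (Fin n → ℝ) → ℝ := ∑ j, fun x => f (x j) with hB
  have hcomp : ∀ j, MemLp (fun x : Fin n → ℝ => f (x j)) 2 π := fun j =>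
    hf2.comp_measurePreserving (measurePreserving_eval (fun _ : Fin n => gaussianReal 0 1) j)
  have hEB : ∫ x, B x ∂π = n * p := by
    simp only [hB, Finset.sum_apply]
    rw [integral_finsetSum _ fun j _ => (hcomp j).integrable (by norm_num)]
    have : ∀ j, ∫ x : Fin n → ℝ, f (x j) ∂π = p := fun j => by
      rw [← hEf, ← (measurePreserving_eval (fun _ : Fin n => gaussianReal 0 1) j).map_eq,
        integral_map (measurable_pi_apply j).aemeasurable hfm.aestronglyMeasurable]
    simp [this]
  have hVB : Var[B; π] ≤ n * p := by
    rw [hB, variance_sum_pi fun _ => hf2]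
    calc _ ≤ ∑ _j : Fin n, p := Finset.sum_le_sum fun j _ => hVf
      _ = _ := by simp
  have hB2 : MemLp B 2 π := memLp_finsetSum' _ fun j _ => hcomp j
  have hnp : 8 ≤ n * p := by
    have : (0 : ℝ) ≤ (i : ℕ) := by positivity
    linarith
  have hcheb := meas_ge_le_variance_div_sq hB2 (c := n * p / 2) (by linarith)
  rw [hEB] at hcheb
  have hbad : π.real {x | n * p / 2 ≤ |B x - n * p|} ≤ 1 / 2 := by
    refine (ENNReal.toReal_mono ENNReal.ofReal_ne_top hcheb).trans ?_
    rw [ENNReal.toReal_ofReal (div_nonneg (variance_nonneg _ _) (sq_nonneg _)),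
      div_le_div_iff₀ (by positivity) two_pos]
    nlinarith
  have hBm : Measurable B := by
    have : B = fun x => ∑ j, f (x j) := by ext x; simp [hB]
    rw [this]
    exact Finset.measurable_sum _ fun j _ => hfm.comp (measurable_pi_apply j)
  have hbadm : MeasurableSet {x | n * p / 2 ≤ |B x - n * p|} :=
    measurableSet_le measurable_const (hBm.sub_const _).abs
  have hgood : {x | n * p / 2 ≤ |B x - n * p|}ᶜ
      ⊆ WithLp.toLp 2 ⁻¹' {x : EuclideanSpace ℝ (Fin n) | t ≤ decRearr x i} := by
    intro x hx
    simp only [Set.mem_compl_iff, Set.mem_ofPred_eq, not_le] at hx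
    refine le_decRearr_of_lt_sum_indicator _ i t ?_
    have h1 : B x = ∑ j, if t ≤ |x j| then (1 : ℝ) else 0 := by
      simp [hB, hf, Set.indicator_apply]
    have h2 := (abs_lt.mp hx).1
    change ((i : ℕ) : ℝ) < ∑ j, if t ≤ |x j| then (1 : ℝ) else 0
    rw [← h1]
    have : (0 : ℝ) ≤ (i : ℕ) := by positivity
    linarith
  have hm : MeasurableSet {x : EuclideanSpace ℝ (Fin n) | t ≤ decRearr x i} :=
    measurableSet_le measurable_const (measurable_decRearr i)
  rw [← map_pi_eq_stdGaussian, map_measureReal_apply (by fun_prop) hm]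
  refine le_trans ?_ (measureReal_mono hgood)
  rw [probReal_compl_eq_one_sub hbadm]
  linarith

theorem abs_decRearr_le_norm (x : EuclideanSpace ℝ (Fin n)) (i : Fin n) :
    |decRearr x i| ≤ ‖x‖ := by
  rw [abs_of_nonneg (decRearr_nonneg x i)]
  exact PiLp.norm_apply_le x _

theorem integrable_decRearr (i : Fin n) :
    Integrable (fun x => decRearr x i) (stdGaussian (EuclideanSpace ℝ (Fin n))) :=
  IsGaussian.integrable_id.norm.mono' (measurable_decRearr i).aestronglyMeasurable
    (Filter.Eventually.of_forall fun x => abs_decRearr_le_norm x i)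

/-- The non-increasing rearrangement of a standard gaussian vector is, in expectation, at least the
gaussian profile, up to constants. -/
theorem gaussianProfile_le_integral_decRearr (i : Fin n) :
    gaussianProfile n i ≤ 2 * (∫ x, decRearr x i ∂(stdGaussian (EuclideanSpace ℝ (Fin n)))) + 3 := by
  have hn : (0 : ℝ) < n := by exact_mod_cast i.pos
  set w := ∫ x, decRearr x i ∂(stdGaussian (EuclideanSpace ℝ (Fin n))) with hw
  have hw0 : 0 ≤ w := integral_nonneg fun x => decRearr_nonneg x i
  rw [gaussianProfile_apply]
  set l := Real.log (n / ((i : ℕ) + 1)) with hl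
  rcases le_or_gt l 5 with h5 | h5
  · have : Real.sqrt (1 + l) ≤ 3 := by
      rw [Real.sqrt_le_left (by norm_num)]; linarith
    linarith
  -- the level at which `exp (-2 - t ^ 2) ≥ 8 (i + 1) / n`, since `8 ≤ exp 3`
  set t := Real.sqrt (l - 5) with ht
  have ht0 : 0 ≤ t := Real.sqrt_nonneg _
  have ht2 : t ^ 2 = l - 5 := Real.sq_sqrt (by linarith)
  have hp : 8 * ((i : ℕ) + 1 : ℝ) ≤ n * (gaussianReal 0 1).real {u | t ≤ |u|} := by
    have h1 := exp_neg_le_gaussianReal_le_abs ht0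
    have h2 : Real.exp (-2 - t ^ 2) = Real.exp 3 * (((i : ℕ) + 1) / n) := by
      rw [ht2, show -2 - (l - 5) = 3 + -l by ring, Real.exp_add, Real.exp_neg, hl,
        Real.exp_log (by positivity), inv_div]
    have h3 : (8 : ℝ) ≤ Real.exp 3 := by
      have := Real.exp_one_gt_d9
      rw [show (3 : ℝ) = (3 : ℕ) * 1 by norm_num, Real.exp_nat_mul]
      calc (8 : ℝ) = 2 ^ 3 := by norm_num
        _ ≤ _ := by gcongr; linarith
    calc 8 * ((i : ℕ) + 1 : ℝ) ≤ Real.exp 3 * ((i : ℕ) + 1) := by gcongr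
      _ = n * (Real.exp 3 * (((i : ℕ) + 1) / n)) := by field_simp
      _ ≤ _ := by rw [← h2]; gcongr
  have hhalf := half_le_stdGaussian_le_decRearr i hp
  have hmarkov := mul_meas_ge_le_integral_of_nonneg
    (μ := stdGaussian (EuclideanSpace ℝ (Fin n)))
    (Filter.Eventually.of_forall fun x => decRearr_nonneg x i) (integrable_decRearr i) t
  have h6 : t / 2 ≤ w := by
    refine le_trans ?_ hmarkov
    calc t / 2 = t * (1 / 2) := by ring
      _ ≤ _ := by gcongr
  have h7 : Real.sqrt (1 + l) ≤ t + 3 := by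
    rw [Real.sqrt_le_left (by linarith)]
    nlinarith
  linarith

theorem integral_euclidean_apply {α : Type*} [MeasurableSpace α] {μ : Measure α}
    {Z : α → EuclideanSpace ℝ (Fin n)} (hZ : Integrable Z μ) (i : Fin n) :
    (∫ ω, Z ω ∂μ) i = ∫ ω, Z ω i ∂μ :=
  ((EuclideanSpace.proj (𝕜 := ℝ) i).integral_comp_comm hZ).symm

theorem integrable_toLp {α : Type*} [MeasurableSpace α] {μ : Measure α}
    {Z : α → Fin n → ℝ} (hZ : ∀ i, Integrable (fun ω => Z ω i) μ) :
    Integrable (fun ω => (WithLp.toLp 2 (Z ω) : EuclideanSpace ℝ (Fin n))) μ :=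
  (PiLp.continuousLinearEquiv 2 ℝ fun _ : Fin n => ℝ).symm.toContinuousLinearMap.integrable_comp
    (Integrable.of_eval hZ)

theorem ellStar_eq_integral_polarNorm (V : Set (EuclideanSpace ℝ (Fin n))) :
    ellStar V = ∫ g, polarNorm V g ∂(stdGaussian (EuclideanSpace ℝ (Fin n))) := by
  simp only [ellStar, polarNorm, real_inner_comm]

/-- The mean width `ℓ_*(V)` of a set with `K`-unconditional polar seminorm dominates the polar
seminorm of the gaussian profile: by Jensen's inequality `E ‖G‖` dominates both `‖E |G|‖` and
`‖E G^*‖`, which control the flat and the peaked part of the profile. -/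
theorem exists_polarNorm_gaussianProfile_le :
    ∃ c : ℝ, 0 < c ∧ ∀ (n : ℕ) (K : ℝ) (V : Set (EuclideanSpace ℝ (Fin n))), 1 ≤ K →
      Bornology.IsBounded V → IsKUnconditional K (polarNorm V) →
      polarNorm V (gaussianProfile n) ≤ c * K ^ 2 * ellStar V := by
  set c₀ := ∫ u, |u| ∂(gaussianReal 0 1) with hc₀
  have hint1 : Integrable (fun u : ℝ => |u|) (gaussianReal 0 1) :=
    (IsGaussian.integrable_id (μ := gaussianReal 0 1)).abs
  have hc₀pos : 0 < c₀ := by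
    have h1 := mul_meas_ge_le_integral_of_nonneg (μ := gaussianReal 0 1)
      (Filter.Eventually.of_forall fun u : ℝ => abs_nonneg u) hint1 1
    have h2 := exp_neg_le_gaussianReal_le_abs zero_le_one
    have h3 := Real.exp_pos (-2 - 1 ^ 2)
    rw [one_mul] at h1
    exact h3.trans_le (h2.trans h1)
  refine ⟨2 + 3 / c₀, by positivity, fun n K V hK1 hV hK => ?_⟩
  set γ := stdGaussian (EuclideanSpace ℝ (Fin n)) with hγ
  have hK0 : 0 < K := by linarith
  rw [ellStar_eq_integral_polarNorm]
  set ℓ := ∫ g, polarNorm V g ∂γ with hℓ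
  have hνint : Integrable (fun g => polarNorm V g) γ :=
    integrable_polarNorm hV IsGaussian.integrable_id
  have hjensen : ∀ Z : EuclideanSpace ℝ (Fin n) → EuclideanSpace ℝ (Fin n), Integrable Z γ →
      (∀ g, decRearr (Z g) = decRearr g) → polarNorm V (∫ g, Z g ∂γ) ≤ K * ℓ := by
    intro Z hZ hZg
    refine (polarNorm_integral_le hV hZ).trans ?_
    rw [hℓ, ← integral_const_mul]
    refine integral_mono (integrable_polarNorm hV hZ) (hνint.const_mul K) fun g => ?_
    exact hK.2 _ _ fun i => by rw [hZg]
  have hcoord : ∀ i : Fin n, Integrable (fun g : EuclideanSpace ℝ (Fin n) => |g i|) γ := fun i =>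
    (((EuclideanSpace.proj (𝕜 := ℝ) i).integrable_comp
      (IsGaussian.integrable_id (μ := γ))).abs)
  have habs := integrable_toLp (Z := fun (g : EuclideanSpace ℝ (Fin n)) i => |g i|) hcoord
  have hdec := integrable_toLp (Z := fun (g : EuclideanSpace ℝ (Fin n)) i => decRearr g i)
    fun i => integrable_decRearr i
  set m := ∫ g : EuclideanSpace ℝ (Fin n), (WithLp.toLp 2 (fun i => |g i|) :
    EuclideanSpace ℝ (Fin n)) ∂γ with hm
  set w := ∫ g : EuclideanSpace ℝ (Fin n), (WithLp.toLp 2 (fun i => decRearr g i) :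
    EuclideanSpace ℝ (Fin n)) ∂γ with hw
  have hmν : polarNorm V m ≤ K * ℓ := hjensen _ habs fun g =>
    decRearr_congr_abs fun i => abs_abs _
  have hwν : polarNorm V w ≤ K * ℓ := hjensen _ hdec fun g => funext fun i => decRearr_decRearr g i
  have hmi : ∀ i, m i = c₀ := fun i => by
    rw [hm, integral_euclidean_apply habs, hγ, ← map_pi_eq_stdGaussian,
      integral_map (by fun_prop) (by fun_prop)]
    change ∫ x : Fin n → ℝ, |x i| ∂(Measure.pi fun _ => gaussianReal 0 1) = c₀
    have hmp := measurePreserving_eval (fun _ : Fin n => gaussianReal 0 1) i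
    calc _ = ∫ u, |u| ∂((Measure.pi fun _ : Fin n => gaussianReal 0 1).map (Function.eval i)) :=
          (integral_map hmp.aemeasurable (by fun_prop)).symm
      _ = c₀ := by rw [hmp.map_eq]
  have hwi : ∀ i, w i = ∫ g, decRearr g i ∂γ := fun i => by
    rw [hw, integral_euclidean_apply hdec]
  set y := (2 : ℝ) • w + (3 / c₀) • m with hy
  have hyi : ∀ i, y i = 2 * (∫ g, decRearr g i ∂γ) + 3 := fun i => by
    simp only [hy, PiLp.add_apply, PiLp.smul_apply, smul_eq_mul, hwi, hmi]
    rw [div_mul_cancel₀ _ hc₀pos.ne']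
  have hcmp : polarNorm V (gaussianProfile n) ≤ K * (1 * polarNorm V y) := by
    refine hK.polarNorm_le_mul zero_le_one (fun i j hij => ?_) (fun i => ?_) fun i => ?_
    · simp only [hyi]
      have := integral_mono (μ := γ) (integrable_decRearr j) (integrable_decRearr i)
        fun g => decRearr_antitone g hij
      linarith
    · rw [hyi]
      have : 0 ≤ ∫ g, decRearr g i ∂γ := integral_nonneg fun g => decRearr_nonneg g i
      linarith
    · rw [decRearr_of_antitone gaussianProfile_antitone gaussianProfile_nonneg, one_mul, hyi]
      exact gaussianProfile_le_integral_decRearr i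
  calc polarNorm V (gaussianProfile n) ≤ K * (1 * polarNorm V y) := hcmp
    _ ≤ K * (2 * polarNorm V w + 3 / c₀ * polarNorm V m) := by
        have := polarNorm_add_le hV ((2 : ℝ) • w) ((3 / c₀) • m)
        rw [polarNorm_smul, polarNorm_smul, abs_of_pos two_pos,
          abs_of_pos (by positivity : 0 < 3 / c₀)] at this
        rw [one_mul]
        gcongr
    _ ≤ K * (2 * (K * ℓ) + 3 / c₀ * (K * ℓ)) := by gcongr
    _ = _ := by ring

end Gaussian

/-! ### Symmetrization -/

section Symmetrization

variable {n N : ℕ} {V : Set (EuclideanSpace ℝ (Fin n))} {Ω : Type*} [MeasurableSpace Ω]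
  {P : Measure Ω} [IsProbabilityMeasure P]

/-- Adding an independent centred vector does not decrease the expected seminorm. -/
theorem integral_polarNorm_le_integral_polarNorm_add (hV : Bornology.IsBounded V)
    {U W : Ω → EuclideanSpace ℝ (Fin n)} (hU : Integrable U P) (hW : Integrable W P)
    (hUW : IndepFun U W P) (hW0 : ∫ ω, W ω ∂P = 0) :
    ∫ ω, polarNorm V (U ω) ∂P ≤ ∫ ω, polarNorm V (U ω + W ω) ∂P := by
  have hUm := hU.aemeasurable
  have hWm := hW.aemeasurable
  have hνm : ∀ μ : Measure (EuclideanSpace ℝ (Fin n)), AEStronglyMeasurable (polarNorm V) μ :=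
    fun μ => (continuous_polarNorm hV).aestronglyMeasurable
  have hlaw := (indepFun_iff_map_prod_eq_prod_map_map hUm hWm).mp hUW
  have : IsProbabilityMeasure (P.map U) := Measure.isProbabilityMeasure_map hUm
  have : IsProbabilityMeasure (P.map W) := Measure.isProbabilityMeasure_map hWm
  have hadd : Continuous fun z : EuclideanSpace ℝ (Fin n) × EuclideanSpace ℝ (Fin n) =>
      polarNorm V (z.1 + z.2) := (continuous_polarNorm hV).comp (by fun_prop)
  have hint : Integrable (fun z : EuclideanSpace ℝ (Fin n) × EuclideanSpace ℝ (Fin n) =>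
      polarNorm V (z.1 + z.2)) ((P.map U).prod (P.map W)) := by
    rw [← hlaw, integrable_map_measure hadd.aestronglyMeasurable (hUm.prodMk hWm)]
    exact integrable_polarNorm hV (hU.add hW)
  have hWid : Integrable (fun w => w) (P.map W) :=
    (integrable_map_measure (by fun_prop) hWm).mpr hW
  have hWid0 : ∫ w, w ∂(P.map W) = 0 := by
    rw [integral_map hWm (by fun_prop), hW0]
  have hUid : Integrable (fun u => u) (P.map U) :=
    (integrable_map_measure (by fun_prop) hUm).mpr hU
  calc ∫ ω, polarNorm V (U ω) ∂P = ∫ u, polarNorm V u ∂(P.map U) :=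
        (integral_map hUm (hνm _)).symm
    _ ≤ ∫ u, ∫ w, polarNorm V (u + w) ∂(P.map W) ∂(P.map U) := by
        refine integral_mono (integrable_polarNorm hV hUid) hint.integral_prod_left fun u => ?_
        have hj := polarNorm_integral_le hV ((integrable_const u).add hWid)
        simp only [Pi.add_apply] at hj
        rw [integral_add (integrable_const u) hWid, hWid0] at hj
        simpa using hj
    _ = ∫ z, polarNorm V (z.1 + z.2) ∂((P.map U).prod (P.map W)) := (integral_prod _ hint).symm
    _ = _ := by
        rw [← hlaw, integral_map (hUm.prodMk hWm) hadd.aestronglyMeasurable]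

/-- Symmetrization with *fixed* signs: split the sum according to the sign, and apply Jensen's
inequality to each of the two parts. -/
theorem integral_polarNorm_sum_le_two_mul (hV : Bornology.IsBounded V)
    {U : Fin N → Ω → EuclideanSpace ℝ (Fin n)} (hU : ∀ i, Integrable (U i) P)
    (hind : iIndepFun U P) (hU0 : ∀ i, ∫ ω, U i ω ∂P = 0) (s : Fin N → Bool) :
    ∫ ω, polarNorm V (∑ i, U i ω) ∂P
      ≤ 2 * ∫ ω, polarNorm V (∑ i, boolSign (s i) • U i ω) ∂P := by
  have hpart : ∀ S : Finset (Fin N), ∫ ω, polarNorm V (∑ i ∈ S, U i ω) ∂P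
      ≤ ∫ ω, polarNorm V (∑ i ∈ S, U i ω + -∑ i ∈ Sᶜ, U i ω) ∂P := by
    intro S
    refine integral_polarNorm_le_integral_polarNorm_add hV (integrable_finsetSum _ fun i _ => hU i)
      (integrable_finsetSum _ fun i _ => hU i).neg ?_ ?_
    · have h := hind.indepFun_finset₀ S Sᶜ disjoint_compl_right fun i => (hU i).aemeasurable
      have h' := h.comp (φ := fun v => ∑ i, v i) (ψ := fun v => -∑ i, v i)
        (by fun_prop) (by fun_prop)
      convert h' using 1
      · ext1 ω; exact (Finset.sum_coe_sort S fun i => U i ω).symm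
      · ext1 ω; exact congrArg _ (Finset.sum_coe_sort Sᶜ fun i => U i ω).symm
    · rw [integral_neg, integral_finsetSum _ fun i _ => hU i]
      simp [hU0]
  set S : Finset (Fin N) := Finset.univ.filter fun i => s i = true with hS
  have hsign : ∀ ω, ∑ i, boolSign (s i) • U i ω = ∑ i ∈ S, U i ω + -∑ i ∈ Sᶜ, U i ω := by
    intro ω
    rw [← Finset.sum_add_sum_compl S, ← Finset.sum_neg_distrib]
    congr 1
    · refine Finset.sum_congr rfl fun i hi => ?_
      have : s i = true := by simpa [hS] using hi
      simp [this, boolSign]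
    · refine Finset.sum_congr rfl fun i hi => ?_
      have : s i = false := by simpa [hS] using hi
      simp [this, boolSign]
  have h1 := hpart S
  have h2 := hpart Sᶜ
  rw [compl_compl] at h2
  have h3 : ∀ ω, polarNorm V (∑ i ∈ Sᶜ, U i ω + -∑ i ∈ S, U i ω)
      = polarNorm V (∑ i ∈ S, U i ω + -∑ i ∈ Sᶜ, U i ω) := fun ω => by
    rw [← polarNorm_neg, neg_add, neg_neg, add_comm]
  simp only [h3] at h2
  simp only [hsign]
  have hint : ∀ T : Finset (Fin N), Integrable (fun ω => polarNorm V (∑ i ∈ T, U i ω)) P :=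
    fun T => integrable_polarNorm hV (integrable_finsetSum _ fun i _ => hU i)
  calc _ ≤ ∫ ω, (polarNorm V (∑ i ∈ S, U i ω) + polarNorm V (∑ i ∈ Sᶜ, U i ω)) ∂P := by
        refine integral_mono (hint _) ((hint S).add (hint Sᶜ)) fun ω => ?_
        simp only
        rw [← Finset.sum_add_sum_compl S]
        exact polarNorm_add_le hV _ _
    _ = _ := integral_add (hint S) (hint Sᶜ)
    _ ≤ _ := by linarith

theorem signAvg_abs_sum_le (hN : 1 ≤ N) :
    signAvg (fun s : Fin N → Bool => |(Real.sqrt N)⁻¹ * ∑ i, boolSign (s i)|) ≤ 7 := by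
  have hN0 : (0 : ℝ) < N := by exact_mod_cast hN
  have h := signAvg_pow_le (fun _ : Fin N => (Real.sqrt N)⁻¹) le_rfl
  have h1 : ∑ _i : Fin N, (Real.sqrt N)⁻¹ ^ 2 = 1 := by
    simp [inv_pow, Real.sq_sqrt hN0.le, hN0.ne']
  rw [h1] at h
  calc _ ≤ signAvg (fun s : Fin N → Bool =>
        1 + (∑ i, boolSign (s i) * (Real.sqrt N)⁻¹) ^ (2 * 1)) := by
        refine signAvg_mono fun s => ?_
        rw [← Finset.sum_mul, mul_comm, mul_one]
        set x := (∑ i, boolSign (s i)) * (Real.sqrt N)⁻¹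
        nlinarith [sq_abs x, sq_nonneg (|x| - 1), abs_nonneg x]
    _ ≤ 7 := by
        rw [signAvg_add, signAvg_const]
        have := Real.exp_one_lt_d9
        norm_num at h
        linarith

end Symmetrization

/-! ### The symmetrized sum -/

section SymmetrizedSum

variable {n N : ℕ}

/-- Pointwise in the data `(ξ_i, X_i)`: control of the sign-averaged seminorm by the empirical `L_q`
norm of `ξ` and by a function of the coordinates of the `X_i` alone. The free parameter `s` comes
from the arithmetic-geometric mean inequality. -/
theorem signAvg_polarNorm_le {K : ℝ} {V : Set (EuclideanSpace ℝ (Fin n))} (hK0 : 0 ≤ K)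
    (hK : IsKUnconditional K (polarNorm V)) (hN : 1 ≤ N) {q C s : ℝ} (hq : 2 < q) (hC : 0 < C)
    (hs : 0 < s) {H : ℕ → (Fin N → ℝ) → ℝ}
    (hH : ∀ k, 1 ≤ k → (∀ x, 0 ≤ H k x) ∧ ∀ ξ x : Fin N → ℝ,
      signAvg (fun s => ((Real.sqrt N)⁻¹ * ∑ i, boolSign (s i) * (ξ i * x i)) ^ (2 * k))
          ≤ (((∑ i, |ξ i| ^ q) / N) ^ (1 / q)) ^ (2 * k) * H k x)
    (ξ : Fin N → ℝ) (X : Fin N → EuclideanSpace ℝ (Fin n)) :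
    signAvg (fun σ => polarNorm V ((Real.sqrt N)⁻¹ • ∑ i, boolSign (σ i) • (ξ i • X i)))
      ≤ K * polarNorm V (gaussianProfile n) / 2 *
        ((((∑ i, |ξ i| ^ q) / N) ^ (1 / q)) ^ 2 / s
          + 2 * Real.exp 1 * C * s * (2 + ∑ k ∈ Finset.Icc 1 ⌈1 + Real.log n⌉₊,
            2 * (1 / 2) ^ k * ((∑ j, H k (fun i => X i j)) / (n * (C * k) ^ k)))) := by
  have hN0 : (0 : ℝ) < N := by exact_mod_cast hN
  have hq0 : 0 < q := by linarith
  set A := ((∑ i, |ξ i| ^ q) / N) ^ (1 / q) with hA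
  have hE0 : 0 ≤ ∑ i, |ξ i| ^ q := Finset.sum_nonneg fun i _ => by positivity
  have hA0 : 0 ≤ A := by positivity
  set ν := polarNorm V (gaussianProfile n) with hν
  have hν0 : 0 ≤ ν := polarNorm_nonneg _
  set W : (Fin N → Bool) → EuclideanSpace ℝ (Fin n) := fun σ =>
    (Real.sqrt N)⁻¹ • ∑ i, boolSign (σ i) • (ξ i • X i) with hW
  have hWj : ∀ σ j, W σ j = (Real.sqrt N)⁻¹ * ∑ i, boolSign (σ i) * (ξ i * X i j) := by
    intro σ j
    simp [hW]
  have hAW : ∀ σ, W σ = A • (A⁻¹ • W σ) := by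
    intro σ
    by_cases h0 : A = 0
    · -- all the `ξ i` vanish
      have h1 : ∑ i, |ξ i| ^ q = 0 := by
        have := (Real.rpow_eq_zero (by positivity) (by positivity)).mp h0
        rcases div_eq_zero_iff.mp this with h | h
        · exact h
        · exact absurd h hN0.ne'
      have h2 : ∀ i, ξ i = 0 := fun i => by
        have := (Finset.sum_eq_zero_iff_of_nonneg fun i _ => by positivity).mp h1 i
          (Finset.mem_univ i)
        rwa [Real.rpow_eq_zero (abs_nonneg _) hq0.ne', abs_eq_zero] at this
      simp [hW, h2]
    · rw [smul_smul, mul_inv_cancel₀ h0, one_smul]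
  set Ψ : (Fin N → Bool) → ℝ := fun σ => 2 + ∑ k ∈ Finset.Icc 1 ⌈1 + Real.log n⌉₊,
      2 * (1 / 2) ^ k * ((∑ j, (A⁻¹ • W σ) j ^ (2 * k)) / (n * (C * k) ^ k)) with hΨ
  have hΨ0 : ∀ σ, 0 ≤ Ψ σ := fun σ => by
    refine add_nonneg zero_le_two (Finset.sum_nonneg fun k _ => ?_)
    refine mul_nonneg (by positivity) (div_nonneg (Finset.sum_nonneg fun j _ => ?_) (by positivity))
    rw [pow_mul]; positivity
  have hpt : ∀ σ, polarNorm V (W σ)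
      ≤ K * ν / 2 * (A ^ 2 / s + 2 * Real.exp 1 * C * s * Ψ σ) := by
    intro σ
    set θ := Real.sqrt (2 * Real.exp 1 * C * Ψ σ) with hθ
    have hθ2 : θ ^ 2 = 2 * Real.exp 1 * C * Ψ σ :=
      Real.sq_sqrt (mul_nonneg (by positivity) (hΨ0 σ))
    have h1 : polarNorm V (A⁻¹ • W σ) ≤ K * (θ * ν) :=
      hK.polarNorm_le_mul (Real.sqrt_nonneg _) gaussianProfile_antitone gaussianProfile_nonneg
        fun i => decRearr_le_mul_gaussianProfile _ hC rfl i
    have h2 : A * θ ≤ (A ^ 2 / s + s * θ ^ 2) / 2 := by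
      have : A ^ 2 / s + s * θ ^ 2 - 2 * (A * θ) = (A - s * θ) ^ 2 / s := by field_simp; ring
      have : 0 ≤ (A - s * θ) ^ 2 / s := by positivity
      linarith
    rw [hAW σ, polarNorm_smul, abs_of_nonneg hA0]
    calc A * polarNorm V (A⁻¹ • W σ) ≤ A * (K * (θ * ν)) := by gcongr
      _ = K * ν * (A * θ) := by ring
      _ ≤ K * ν * ((A ^ 2 / s + s * θ ^ 2) / 2) := by gcongr
      _ = _ := by rw [hθ2]; ring
  have hmom : ∀ k, 1 ≤ k → ∀ j,
      signAvg (fun σ => (A⁻¹ • W σ) j ^ (2 * k)) ≤ H k (fun i => X i j) := by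
    intro k hk j
    have h1 := (hH k hk).2 ξ fun i => X i j
    have h2 : ∀ σ, (A⁻¹ • W σ) j ^ (2 * k) = (A⁻¹) ^ (2 * k) *
        ((Real.sqrt N)⁻¹ * ∑ i, boolSign (σ i) * (ξ i * X i j)) ^ (2 * k) := by
      intro σ
      rw [PiLp.smul_apply, hWj, smul_eq_mul, mul_pow]
    simp only [h2, signAvg_const_mul]
    refine (mul_le_mul_of_nonneg_left h1 (by positivity)).trans ?_
    rw [← mul_assoc, ← mul_pow]
    have h3 : (A⁻¹ * A) ^ (2 * k) ≤ 1 := by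
      by_cases h0 : A = 0
      · simp [h0, show k ≠ 0 by omega]
      · simp [h0]
    exact mul_le_of_le_one_left ((hH k hk).1 _) h3
  refine (signAvg_mono hpt).trans ?_
  rw [signAvg_const_mul, signAvg_add, signAvg_const, signAvg_const_mul, hΨ, signAvg_add,
    signAvg_const, signAvg_sum]
  gcongr with k hk
  rw [signAvg_const_mul]
  simp only [div_eq_mul_inv _ ((n : ℝ) * _), mul_comm _ ((n : ℝ) * _)⁻¹, signAvg_const_mul,
    signAvg_sum]
  gcongr with j
  exact hmom k (Finset.mem_Icc.mp hk).1 j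

theorem lintegral_ofReal_abs_rpow_le {Ω : Type*} [MeasurableSpace Ω] {P : Measure Ω}
    {Z : Ω → ℝ} {t b : ℝ} (ht : 0 < t) (hb : 0 ≤ b)
    (h : eLpNorm Z (ENNReal.ofReal t) P ≤ ENNReal.ofReal b) :
    ∫⁻ ω, ENNReal.ofReal (|Z ω| ^ t) ∂P ≤ ENNReal.ofReal (b ^ t) := by
  have h0 : ENNReal.ofReal t ≠ 0 := by simpa using ht
  have h1 : ∫⁻ ω, ENNReal.ofReal (|Z ω| ^ t) ∂P = eLpNorm Z (ENNReal.ofReal t) P ^ t := by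
    rw [eLpNorm_eq_lintegral_rpow_enorm_toReal h0 ENNReal.ofReal_ne_top,
      ENNReal.toReal_ofReal ht.le, ← ENNReal.rpow_mul, one_div, inv_mul_cancel₀ ht.ne',
      ENNReal.rpow_one]
    refine lintegral_congr fun ω => ?_
    rw [← ENNReal.ofReal_rpow_of_nonneg (abs_nonneg _) ht.le, Real.enorm_eq_ofReal_abs]
  rw [h1, ← ENNReal.ofReal_rpow_of_nonneg hb ht.le]
  gcongr

theorem lintegral_comp_eq_lintegral_pi {Ω : Type*} [MeasurableSpace Ω] {P : Measure Ω}
    [IsProbabilityMeasure P] {z : Fin N → Ω → ℝ} (hz : ∀ i, AEMeasurable (z i) P)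
    (hind : iIndepFun z P) {H : (Fin N → ℝ) → ℝ} (hH : Measurable H) :
    ∫⁻ ω, ENNReal.ofReal (H fun i => z i ω) ∂P
      = ∫⁻ x, ENNReal.ofReal (H x) ∂(Measure.pi fun i => P.map (z i)) := by
  rw [← (iIndepFun_iff_map_fun_eq_pi_map hz).mp hind,
    lintegral_map' (by fun_prop) (aemeasurable_pi_lambda _ hz)]

theorem lintegral_map_abs_rpow_le {Ω : Type*} [MeasurableSpace Ω] {P : Measure Ω}
    {Z : Ω → ℝ} (hZ : AEMeasurable Z P) {t b : ℝ} (ht : 0 < t) (hb : 0 ≤ b)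
    (h : eLpNorm Z (ENNReal.ofReal t) P ≤ ENNReal.ofReal b) :
    ∫⁻ u, ENNReal.ofReal (|u| ^ t) ∂(P.map Z) ≤ ENNReal.ofReal (b ^ t) := by
  rw [lintegral_map' (by fun_prop) hZ]
  exact lintegral_ofReal_abs_rpow_le ht hb h

/-- The moments up to order `16 log n` cover four times the number of moments needed. -/
theorem four_mul_le_of_le_ceil {n k : ℕ} (hn : 1 ≤ n) {q p : ℝ} (hq : 2 < q)
    (hp : 16 * Real.log n ≤ p) (hk1 : 1 ≤ k) (hk : k ≤ ⌈1 + Real.log n⌉₊) :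
    (k : ℝ) ≤ q / (q - 2) ∨ 4 * (k : ℝ) ≤ p := by
  rcases hn.eq_or_lt with rfl | hn2
  -- for `n = 1` the logarithm vanishes, and only `k = 1` occurs
  · left
    have : k = 1 := by
      simp at hk; omega
    rw [this, le_div_iff₀ (by linarith)]
    push_cast; linarith
  · right
    have h1 : (k : ℝ) ≤ ⌈1 + Real.log n⌉₊ := by exact_mod_cast hk
    have h2 : Real.log 2 ≤ Real.log n :=
      Real.log_le_log two_pos (by exact_mod_cast hn2)
    have h3 := Real.log_two_gt_d9
    have h4 := Nat.ceil_lt_add_one (show 0 ≤ 1 + Real.log n by linarith)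
    linarith

theorem sum_Icc_two_mul_half_pow (Q : ℕ) :
    ∑ k ∈ Finset.Icc 1 Q, 2 * (1 / 2 : ℝ) ^ k = 2 - 2 * (1 / 2) ^ Q := by
  induction Q with
  | zero => simp
  | succ Q ih => rw [Finset.sum_Icc_succ_top (by omega), ih, pow_succ]; ring

/-- The expected seminorm of the symmetrized normalized multiplier sum is dominated by the seminorm
of the gaussian profile. -/
theorem exists_lintegral_signAvg_polarNorm_le {q L : ℝ} (hq : 2 < q) (hL : 1 ≤ L) :
    ∃ c : ℝ, 0 < c ∧ ∀ (n : ℕ) (K : ℝ) (V : Set (EuclideanSpace ℝ (Fin n))), 1 ≤ K →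
      IsKUnconditional K (polarNorm V) →
      ∀ {Ω : Type*} [MeasurableSpace Ω] (P : Measure Ω) [IsProbabilityMeasure P] (N : ℕ), 1 ≤ N →
      ∀ (Xs : Fin N → Ω → EuclideanSpace ℝ (Fin n)) (ξs : Fin N → Ω → ℝ),
      (∀ i, AEMeasurable (fun ω => (Xs i ω, ξs i ω)) P) →
      iIndepFun (fun i ω => (Xs i ω, ξs i ω)) P →
      ∀ s : ℝ, 0 < s → (∀ i, eLpNorm (ξs i) (ENNReal.ofReal q) P ≤ ENNReal.ofReal s) →
      (∀ i j, ∀ t : ℝ, 1 ≤ t → t ≤ max (16 * Real.log n) (2 * q / (q - 2)) →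
        eLpNorm (fun ω => Xs i ω j) (ENNReal.ofReal t) P ≤ ENNReal.ofReal (L * Real.sqrt t)) →
      ∫⁻ ω, ENNReal.ofReal (signAvg fun σ => polarNorm V
          ((Real.sqrt N)⁻¹ • ∑ i, boolSign (σ i) • (ξs i ω • Xs i ω))) ∂P
        ≤ ENNReal.ofReal (c * (K * s * polarNorm V (gaussianProfile n))) := by
  obtain ⟨C, hC, hCH⟩ := exists_signAvg_moment_bound hq hL
  refine ⟨1 + 4 * Real.exp 1 * C, by positivity, ?_⟩
  intro n K V hK1 hK Ω _ P _ N hN Xs ξs hm hind s hs hξ hX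
  have hN0 : (0 : ℝ) < N := by exact_mod_cast hN
  have hq0 : 0 < q := by linarith
  choose H hHm hH0 hHavg hHint using fun k (hk : 1 ≤ k) => hCH N hN k hk
  -- extended by zero to `k = 0`, which does not occur
  set H' : ℕ → (Fin N → ℝ) → ℝ := fun k => if hk : 1 ≤ k then H k hk else 0 with hH'
  have hH'eq : ∀ k (hk : 1 ≤ k), H' k = H k hk := fun k hk => by simp [hH', hk]
  have hXm : ∀ i j, AEMeasurable (fun ω => Xs i ω j) P := fun i j =>
    (by fun_prop : Measurable fun z : EuclideanSpace ℝ (Fin n) × ℝ => z.1 j).comp_aemeasurable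
      (hm i)
  have hξm : ∀ i, AEMeasurable (ξs i) P := fun i => measurable_snd.comp_aemeasurable (hm i)
  have hXind : ∀ j, iIndepFun (fun i ω => Xs i ω j) P := fun j =>
    hind.comp (fun _ z => z.1 j) fun _ => by fun_prop
  have hξind : iIndepFun ξs P := hind.comp (fun _ z => z.2) fun _ => measurable_snd
  set B := K * polarNorm V (gaussianProfile n) / 2 with hB
  have hB0 : 0 ≤ B := by
    have := polarNorm_nonneg (V := V) (gaussianProfile n)
    positivity
  have hpt := fun ω => signAvg_polarNorm_le (by linarith : 0 ≤ K) hK hN hq hC hs (H := H')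
    (fun k hk => by rw [hH'eq k hk]; exact ⟨hH0 k hk, hHavg k hk⟩) (fun i => ξs i ω)
    (fun i => Xs i ω)
  set A2 : (Fin N → ℝ) → ℝ := fun ξ => (((∑ i, |ξ i| ^ q) / N) ^ (1 / q)) ^ 2 with hA2
  set Φ : Ω → ℝ := fun ω => ∑ k ∈ Finset.Icc 1 ⌈1 + Real.log n⌉₊,
    2 * (1 / 2) ^ k * ((∑ j, H' k (fun i => Xs i ω j)) / (n * (C * k) ^ k)) with hΦ
  have hA2int : ∫⁻ ω, ENNReal.ofReal (A2 fun i => ξs i ω) ∂P ≤ ENNReal.ofReal (2 * s ^ 2) := by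
    have hA2m : Measurable A2 := by fun_prop
    have : ∀ i, IsProbabilityMeasure (P.map (ξs i)) := fun i =>
      Measure.isProbabilityMeasure_map (hξm i)
    rw [lintegral_comp_eq_lintegral_pi hξm hξind hA2m]
    have h1 := lintegral_pi_empirical_le (fun i => P.map (ξs i)) hN
      (g := fun u => |u| ^ q) (by fun_prop) (fun u => by positivity)
      fun i => lintegral_map_abs_rpow_le (hξm i) hq0 hs.le (hξ i)
    have hsq : 0 < s ^ q := by positivity
    have h2 := lintegral_ofReal_const_mul_le (inv_nonneg.mpr hsq.le) h1
    rw [inv_mul_cancel₀ hsq.ne'] at h2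
    have h3 := lintegral_ofReal_const_mul_le (sq_nonneg s)
      (lintegral_ofReal_one_add_le (fun x => by positivity) zero_le_one h2)
    refine (lintegral_mono fun x => ENNReal.ofReal_le_ofReal ?_).trans
      (h3.trans (ENNReal.ofReal_le_ofReal (by linarith)))
    set v := (∑ i, |x i| ^ q) / N with hv
    have hv0 : 0 ≤ v := by positivity
    have h4 := rpow_pow_le_one_add_pow (T := (s ^ q)⁻¹ * v) (p := 1 / q) (j := 2) (n := 1)
      (by positivity) (by positivity) (by
        rw [one_div_mul_eq_div, div_le_iff₀ hq0]; push_cast; linarith)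
    rw [pow_one] at h4
    have h5 : ((s ^ q)⁻¹ * v) ^ (1 / q) = s⁻¹ * v ^ (1 / q) := by
      rw [Real.mul_rpow (by positivity) hv0, Real.inv_rpow hsq.le, ← Real.rpow_mul hs.le,
        mul_one_div_cancel hq0.ne', Real.rpow_one]
    rw [h5] at h4
    calc A2 x = s ^ 2 * (s⁻¹ * v ^ (1 / q)) ^ 2 := by
          change (v ^ (1 / q)) ^ 2 = _
          field_simp
      _ ≤ _ := by gcongr
  have hHX : ∀ k ∈ Finset.Icc 1 ⌈1 + Real.log n⌉₊, ∀ j : Fin n,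
      ∫⁻ ω, ENNReal.ofReal (H' k fun i => Xs i ω j) ∂P ≤ ENNReal.ofReal ((C * k) ^ k) := by
    intro k hk j
    obtain ⟨hk1, hkQ⟩ := Finset.mem_Icc.mp hk
    have : ∀ i, IsProbabilityMeasure (P.map fun ω => Xs i ω j) := fun i =>
      Measure.isProbabilityMeasure_map (hXm i j)
    rw [hH'eq k hk1, lintegral_comp_eq_lintegral_pi (fun i => hXm i j) (hXind j) (hHm k hk1)]
    refine hHint k hk1 _ (max (16 * Real.log n) (2 * q / (q - 2))) (le_max_right _ _)
      (four_mul_le_of_le_ceil (Nat.one_le_iff_ne_zero.mpr j.pos.ne') hq (le_max_left _ _) hk1 hkQ)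
      fun i t ht1 ht => ?_
    exact lintegral_map_abs_rpow_le (hXm i j) (by linarith) (by positivity) (hX i j t ht1 ht)
  have hHm' : ∀ k ∈ Finset.Icc 1 ⌈1 + Real.log n⌉₊, ∀ j : Fin n,
      AEMeasurable (fun ω => H' k fun i => Xs i ω j) P := by
    intro k hk j
    rw [hH'eq k (Finset.mem_Icc.mp hk).1]
    exact (hHm k _).comp_aemeasurable (aemeasurable_pi_lambda _ fun i => hXm i j)
  have hH'0 : ∀ k ∈ Finset.Icc 1 ⌈1 + Real.log n⌉₊, ∀ x, 0 ≤ H' k x := by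
    intro k hk x
    rw [hH'eq k (Finset.mem_Icc.mp hk).1]
    exact hH0 k _ x
  have hΦ0 : ∀ ω, 0 ≤ Φ ω := fun ω => Finset.sum_nonneg fun k hk => mul_nonneg (by positivity)
    (div_nonneg (Finset.sum_nonneg fun j _ => hH'0 k hk _) (by positivity))
  have hΦint : ∫⁻ ω, ENNReal.ofReal (Φ ω) ∂P ≤ ENNReal.ofReal 2 := by
    have hterm : ∀ k ∈ Finset.Icc 1 ⌈1 + Real.log n⌉₊,
        ∫⁻ ω, ENNReal.ofReal (2 * (1 / 2) ^ k *
          ((∑ j, H' k (fun i => Xs i ω j)) / (n * (C * k) ^ k))) ∂P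
        ≤ ENNReal.ofReal (2 * (1 / 2) ^ k) := by
      intro k hk
      have h1 : ∫⁻ ω, ENNReal.ofReal (∑ j, H' k (fun i => Xs i ω j)) ∂P
          ≤ ENNReal.ofReal (n * (C * k) ^ k) := by
        simp only [fun ω => ENNReal.ofReal_sum_of_nonneg (s := Finset.univ)
          (f := fun j => H' k (fun i => Xs i ω j)) fun j _ => hH'0 k hk _]
        rw [lintegral_finsetSum' _ fun j _ => (hHm' k hk j).ennreal_ofReal]
        calc _ ≤ ∑ _j : Fin n, ENNReal.ofReal ((C * k) ^ k) :=
              Finset.sum_le_sum fun j _ => hHX k hk j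
          _ = _ := by rw [ENNReal.ofReal_mul (by positivity)]; simp
      have h2 := lintegral_ofReal_const_mul_le
        (by positivity : 0 ≤ 2 * (1 / 2 : ℝ) ^ k * (n * (C * k) ^ k)⁻¹) h1
      refine (lintegral_mono fun ω => ENNReal.ofReal_le_ofReal (le_of_eq ?_)).trans
        (h2.trans (ENNReal.ofReal_le_ofReal ?_))
      · ring
      · rw [mul_assoc]
        exact mul_le_of_le_one_right (by positivity) (by rw [inv_mul_eq_div]; exact div_self_le_one _)
    simp only [hΦ]
    simp only [fun ω => ENNReal.ofReal_sum_of_nonneg (s := Finset.Icc 1 ⌈1 + Real.log n⌉₊)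
      (f := fun k => 2 * (1 / 2) ^ k * ((∑ j, H' k (fun i => Xs i ω j)) / (n * (C * k) ^ k)))
      fun k hk => mul_nonneg (by positivity)
        (div_nonneg (Finset.sum_nonneg fun j _ => hH'0 k hk _) (by positivity))]
    rw [lintegral_finsetSum' _ fun k hk => (((Finset.aemeasurable_fun_sum _ fun j _ =>
      hHm' k hk j).div_const _).const_mul _).ennreal_ofReal]
    calc _ ≤ ∑ k ∈ Finset.Icc 1 ⌈1 + Real.log n⌉₊, ENNReal.ofReal (2 * (1 / 2) ^ k) :=
          Finset.sum_le_sum hterm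
      _ = ENNReal.ofReal (∑ k ∈ Finset.Icc 1 ⌈1 + Real.log n⌉₊, 2 * (1 / 2) ^ k) :=
          (ENNReal.ofReal_sum_of_nonneg fun k _ => by positivity).symm
      _ ≤ _ := by
          refine ENNReal.ofReal_le_ofReal ?_
          rw [sum_Icc_two_mul_half_pow, sub_le_self_iff]
          positivity
  have hA20 : ∀ ξ, 0 ≤ A2 ξ := fun ξ => by positivity
  have hA2m : AEMeasurable (fun ω => A2 fun i => ξs i ω) P :=
    (by fun_prop : Measurable A2).comp_aemeasurable (aemeasurable_pi_lambda _ hξm)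
  have h1 := lintegral_ofReal_const_mul_le (by positivity : 0 ≤ B * s⁻¹) hA2int
  have h2 := lintegral_ofReal_const_mul_le (by positivity : 0 ≤ B * (2 * Real.exp 1 * C * s))
    (lintegral_ofReal_one_add_le (f := fun ω => 1 + Φ ω) (fun ω => add_nonneg zero_le_one (hΦ0 ω))
      (by positivity) (lintegral_ofReal_one_add_le hΦ0 zero_le_two hΦint))
  calc _ ≤ ∫⁻ ω, (ENNReal.ofReal (B * s⁻¹ * A2 fun i => ξs i ω)
          + ENNReal.ofReal (B * (2 * Real.exp 1 * C * s) * (1 + (1 + Φ ω)))) ∂P := by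
        refine lintegral_mono fun ω => ?_
        rw [← ENNReal.ofReal_add (mul_nonneg (by positivity) (hA20 _))
          (mul_nonneg (by positivity) (by linarith [hΦ0 ω]))]
        refine ENNReal.ofReal_le_ofReal ((hpt ω).trans (le_of_eq ?_))
        simp only [hA2, hΦ]
        ring
    _ ≤ ENNReal.ofReal (B * s⁻¹ * (2 * s ^ 2))
          + ENNReal.ofReal (B * (2 * Real.exp 1 * C * s) * (1 + (1 + 2))) := by
        rw [lintegral_add_left' (hA2m.const_mul _).ennreal_ofReal]
        exact add_le_add h1 h2
    _ = _ := by
        rw [← ENNReal.ofReal_add (by positivity) (by positivity)]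
        congr 1
        rw [hB]
        field_simp
        ring

end SymmetrizedSum

/-! ### The multiplier process -/

section Multiplier

variable {n : ℕ}

theorem eLpNorm_le_of_localNorm_le {Ω : Type*} [MeasurableSpace Ω] {P : Measure Ω} {Z : Ω → ℝ}
    {p L t : ℝ} (hL : 0 ≤ L) (h : localNorm P Z p ≤ ENNReal.ofReal L) (ht1 : 1 ≤ t) (htp : t ≤ p) :
    eLpNorm Z (ENNReal.ofReal t) P ≤ ENNReal.ofReal (L * Real.sqrt t) := by
  have h1 := (le_iSup₂ (f := fun q (_ : q ∈ Set.Icc (1 : ℝ) p) =>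
    eLpNorm Z (ENNReal.ofReal q) P / ENNReal.ofReal (Real.sqrt q)) t ⟨ht1, htp⟩).trans h
  have h2 : 0 < Real.sqrt t := Real.sqrt_pos.mpr (by linarith)
  rw [ENNReal.div_le_iff (by simpa using h2) ENNReal.ofReal_ne_top] at h1
  rwa [ENNReal.ofReal_mul hL]

/-- The Cauchy–Schwarz inequality, with any positive upper bound `s` for the `L_2` norm of `f`. -/
theorem abs_integral_mul_le {Ω : Type*} [MeasurableSpace Ω] {P : Measure Ω}
    [IsProbabilityMeasure P] {f g : Ω → ℝ} (hf : MemLp f 2 P) (hg : MemLp g 2 P) {s : ℝ}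
    (hs : 0 < s) (hfs : eLpNorm f 2 P ≤ ENNReal.ofReal s) (hg1 : ∫ ω, g ω ^ 2 ∂P = 1) :
    |∫ ω, f ω * g ω ∂P| ≤ s := by
  have hf2 : ∫ ω, f ω ^ 2 ∂P ≤ s ^ 2 := by
    have h := lintegral_ofReal_abs_rpow_le (P := P) (Z := f) two_pos hs.le (by simpa using hfs)
    rw [integral_eq_lintegral_of_nonneg_ae (Filter.Eventually.of_forall fun ω => sq_nonneg _)
      (hf.aestronglyMeasurable.pow 2)]
    refine ENNReal.toReal_le_of_le_ofReal (sq_nonneg s) ?_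
    simpa using h
  have hfi := hf.integrable_sq
  have hgi := hg.integrable_sq
  calc |∫ ω, f ω * g ω ∂P| ≤ ∫ ω, |f ω * g ω| ∂P := abs_integral_le_integral_abs
    _ ≤ ∫ ω, ((2 * s)⁻¹ * f ω ^ 2 + s / 2 * g ω ^ 2) ∂P := by
        refine integral_mono (hf.integrable_mul hg).abs
          ((hfi.const_mul _).add (hgi.const_mul _)) fun ω => ?_
        have h1 : (2 * s)⁻¹ * f ω ^ 2 + s / 2 * g ω ^ 2 - |f ω * g ω|
            = (|f ω| - s * |g ω|) ^ 2 / (2 * s) := by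
          rw [abs_mul, ← sq_abs (f ω), ← sq_abs (g ω)]
          field_simp
          ring
        have h2 : 0 ≤ (|f ω| - s * |g ω|) ^ 2 / (2 * s) := by positivity
        change |f ω * g ω| ≤ _
        linarith
    _ = (2 * s)⁻¹ * ∫ ω, f ω ^ 2 ∂P + s / 2 * ∫ ω, g ω ^ 2 ∂P := by
        rw [integral_add (hfi.const_mul _) (hgi.const_mul _), integral_const_mul,
          integral_const_mul]
    _ ≤ (2 * s)⁻¹ * s ^ 2 + s / 2 * 1 := by
        rw [hg1]
        gcongr
    _ = s := by field_simp; norm_num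

theorem decRearr_le_of_forall_abs_le {x : EuclideanSpace ℝ (Fin n)} {c : ℝ} (h : ∀ i, |x i| ≤ c)
    (i : Fin n) : decRearr x i ≤ c := h _

end Multiplier

theorem theorem1p4 :
    ∃ c₁ : ℝ, 0 < c₁ ∧
    ∀ K L q₀ : ℝ, 1 ≤ K → 1 ≤ L → 2 < q₀ →
    ∃ c₂ : ℝ, 0 < c₂ ∧
    ∀ (n : ℕ) (V : Set (EuclideanSpace ℝ (Fin n))),
      Bornology.IsBounded V →
      IsKUnconditional K (polarNorm V) →
    -- the pair `(X, ξ)`, on a probability space `(Ω₀, P₀)`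
    ∀ {Ω₀ : Type*} [MeasurableSpace Ω₀] (P₀ : Measure Ω₀) [IsProbabilityMeasure P₀]
      (X : Ω₀ → EuclideanSpace ℝ (Fin n)) (ξ : Ω₀ → ℝ),
      MemLp ξ (ENNReal.ofReal q₀) P₀ →
      IsIsotropic P₀ X →
      (∀ j : Fin n,
        localNorm P₀ (fun ω => inner ℝ (X ω) (EuclideanSpace.single j (1 : ℝ)))
          (max (c₁ * Real.log n) (2 * q₀ / (q₀ - 2))) ≤ ENNReal.ofReal L) →
    -- its `N` independent copies, on a probability space `(Ω, P)`
    ∀ {Ω : Type*} [MeasurableSpace Ω] (P : Measure Ω) [IsProbabilityMeasure P]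
      (N : ℕ) (_ : 1 ≤ N)
      (Xs : Fin N → Ω → EuclideanSpace ℝ (Fin n)) (ξs : Fin N → Ω → ℝ),
      iIndepFun (fun i ω => (Xs i ω, ξs i ω)) P →
      (∀ i, IdentDistrib (fun ω => (Xs i ω, ξs i ω)) (fun ω => (X ω, ξ ω)) P P₀) →
      Integrable (fun ω => ⨆ v : V, |(Real.sqrt N)⁻¹ * ∑ i : Fin N,
          (ξs i ω * inner ℝ (Xs i ω) (v : EuclideanSpace ℝ (Fin n))
            - ∫ ω₀, ξ ω₀ * inner ℝ (X ω₀) (v : EuclideanSpace ℝ (Fin n)) ∂P₀)|) P ∧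
      ∫ ω, (⨆ v : V, |(Real.sqrt N)⁻¹ * ∑ i : Fin N,
          (ξs i ω * inner ℝ (Xs i ω) (v : EuclideanSpace ℝ (Fin n))
            - ∫ ω₀, ξ ω₀ * inner ℝ (X ω₀) (v : EuclideanSpace ℝ (Fin n)) ∂P₀)|) ∂P
        ≤ c₂ * (eLpNorm ξ (ENNReal.ofReal q₀) P₀).toReal * ellStar V := by
  refine ⟨16, by norm_num, fun K L q hK1 hL hq => ?_⟩
  obtain ⟨c, hc, hproc⟩ := exists_lintegral_signAvg_polarNorm_le hq hL
  obtain ⟨c', hc', hgauss⟩ := exists_polarNorm_gaussianProfile_le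
  have hK0 : 0 < K := by linarith
  refine ⟨2 * (c + 7) * K * (c' * K ^ 2), by positivity, ?_⟩
  intro n V hV hK Ω₀ _ P₀ _ X ξ hξ hX hloc Ω _ P _ N hN Xs ξs hind hid
  have hN0 : (0 : ℝ) < N := by exact_mod_cast hN
  have hq2 : 0 < q - 2 := by linarith
  have h2p : 2 ≤ max (16 * Real.log n) (2 * q / (q - 2)) := by
    refine le_max_of_le_right ?_
    rw [le_div_iff₀ hq2]; linarith
  -- moments of the coordinates
  have hXmom : ∀ j, ∀ t : ℝ, 1 ≤ t → t ≤ max (16 * Real.log n) (2 * q / (q - 2)) →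
      eLpNorm (fun ω => X ω j) (ENNReal.ofReal t) P₀ ≤ ENNReal.ofReal (L * Real.sqrt t) := by
    intro j t ht1 ht
    have h := hloc j
    simp only [EuclideanSpace.inner_single_right, conj_trivial, one_mul] at h
    exact eLpNorm_le_of_localNorm_le (by linarith) h ht1 ht
  have hXm : ∀ j, AEStronglyMeasurable (fun ω => X ω j) P₀ := fun j =>
    ((by fun_prop : Measurable fun x : EuclideanSpace ℝ (Fin n) => x j).comp_aemeasurable
      hX.1).aestronglyMeasurable
  have hX2 : ∀ j, MemLp (fun ω => X ω j) 2 P₀ := fun j => by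
    refine ⟨hXm j, ?_⟩
    have := hXmom j 2 one_le_two h2p
    rw [ENNReal.ofReal_ofNat] at this
    exact this.trans_lt ENNReal.ofReal_lt_top
  have hXsq : ∀ j, ∫ ω, (X ω j) ^ 2 ∂P₀ = 1 := fun j => by
    have := hX.2 (EuclideanSpace.single j 1)
    simpa [EuclideanSpace.inner_single_right] using this
  have hqE : (2 : ℝ≥0∞) ≤ ENNReal.ofReal q := by
    rw [← ENNReal.ofReal_ofNat]; exact ENNReal.ofReal_le_ofReal hq.le
  have hξ2 : MemLp ξ 2 P₀ := hξ.mono_exponent hqE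
  have hY : Integrable (fun ω => ξ ω • X ω) P₀ := by
    have := integrable_toLp (μ := P₀) (Z := fun ω j => ξ ω * X ω j) fun j =>
      hξ2.integrable_mul (hX2 j)
    exact this
  set m := ∫ ω, ξ ω • X ω ∂P₀ with hm
  have hmj : ∀ j, m j = ∫ ω, ξ ω * X ω j ∂P₀ := fun j => by
    rw [hm, integral_euclidean_apply hY]; rfl
  -- the independent copies
  have hidY : ∀ i, IdentDistrib (fun ω => ξs i ω • Xs i ω) (fun ω => ξ ω • X ω) P P₀ := fun i =>
    (hid i).comp (u := fun z : EuclideanSpace ℝ (Fin n) × ℝ => z.2 • z.1) (by fun_prop)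
  have hYs : ∀ i, Integrable (fun ω => ξs i ω • Xs i ω) P := fun i =>
    (hidY i).integrable_iff.mpr hY
  set U : Fin N → Ω → EuclideanSpace ℝ (Fin n) := fun i ω => ξs i ω • Xs i ω - m with hU
  have hUint : ∀ i, Integrable (U i) P := fun i => (hYs i).sub (integrable_const m)
  have hU0 : ∀ i, ∫ ω, U i ω ∂P = 0 := fun i => by
    simp only [hU]
    rw [integral_sub (hYs i) (integrable_const m), (hidY i).integral_eq]
    simp [hm]
  have hUind : iIndepFun U P :=
    hind.comp (fun _ z => z.2 • z.1 - m) fun _ => by fun_prop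
  have hsup : ∀ ω, (⨆ v : V, |(Real.sqrt N)⁻¹ * ∑ i : Fin N,
      (ξs i ω * inner ℝ (Xs i ω) (v : EuclideanSpace ℝ (Fin n))
        - ∫ ω₀, ξ ω₀ * inner ℝ (X ω₀) (v : EuclideanSpace ℝ (Fin n)) ∂P₀)|)
      = (Real.sqrt N)⁻¹ * polarNorm V (∑ i, U i ω) := by
    intro ω
    have hin : ∀ v : EuclideanSpace ℝ (Fin n),
        ∫ ω₀, ξ ω₀ * inner ℝ (X ω₀) v ∂P₀ = inner ℝ v m := fun v => by
      rw [hm, ← integral_inner hY]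
      refine integral_congr_ae (Filter.Eventually.of_forall fun ω₀ => ?_)
      simp [inner_smul_right, real_inner_comm]
    rw [show (Real.sqrt N)⁻¹ * polarNorm V (∑ i, U i ω)
        = polarNorm V ((Real.sqrt N)⁻¹ • ∑ i, U i ω) by
      rw [polarNorm_smul, abs_of_nonneg (by positivity)]]
    simp only [hin, polarNorm, hU, inner_smul_right, inner_sum, inner_sub_right]
    refine iSup_congr fun v => ?_
    congr 2
    exact Finset.sum_congr rfl fun i _ => by rw [real_inner_comm]
  simp only [hsup]
  have hUsum : Integrable (fun ω => polarNorm V (∑ i, U i ω)) P :=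
    integrable_polarNorm hV (integrable_finsetSum _ fun i _ => hUint i)
  refine ⟨hUsum.const_mul _, ?_⟩
  set ν := polarNorm V (gaussianProfile n) with hν
  have hν0 : 0 ≤ ν := polarNorm_nonneg _
  have hmain : ∀ s : ℝ, 0 < s → eLpNorm ξ (ENNReal.ofReal q) P₀ ≤ ENNReal.ofReal s →
      ∫ ω, (Real.sqrt N)⁻¹ * polarNorm V (∑ i, U i ω) ∂P ≤ 2 * (c + 7) * K * ν * s := by
    intro s hs hξs
    set F : Ω → (Fin N → Bool) → ℝ := fun ω σ =>
      polarNorm V ((Real.sqrt N)⁻¹ • ∑ i, boolSign (σ i) • (ξs i ω • Xs i ω)) with hF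
    have hF0 : ∀ ω σ, 0 ≤ F ω σ := fun ω σ => polarNorm_nonneg _
    have hFint : ∀ σ, Integrable (fun ω => F ω σ) P := fun σ =>
      integrable_polarNorm hV
        ((integrable_finsetSum _ fun i _ => (hYs i).smul (boolSign (σ i))).smul (Real.sqrt N)⁻¹)
    have hmν : polarNorm V m ≤ K * s * ν := by
      rw [mul_assoc]
      refine hK.polarNorm_le_mul hs.le gaussianProfile_antitone gaussianProfile_nonneg fun i => ?_
      refine (decRearr_le_of_forall_abs_le (c := s) (fun j => ?_) i).trans
        (le_mul_of_one_le_right hs.le (one_le_gaussianProfile i))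
      rw [hmj]
      exact abs_integral_mul_le hξ2 (hX2 j) hs
        ((eLpNorm_le_eLpNorm_of_exponent_le hqE hξ.aestronglyMeasurable).trans hξs) (hXsq j)
    have hsigned : ∀ σ : Fin N → Bool,
        ∫ ω, (Real.sqrt N)⁻¹ * polarNorm V (∑ i, U i ω) ∂P
          ≤ 2 * (∫ ω, F ω σ ∂P + |(Real.sqrt N)⁻¹ * ∑ i, boolSign (σ i)| * polarNorm V m) := by
      intro σ
      have h1 := integral_polarNorm_sum_le_two_mul hV hUint hUind hU0 σ
      have h2 : ∀ ω, (Real.sqrt N)⁻¹ * polarNorm V (∑ i, boolSign (σ i) • U i ω)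
          ≤ F ω σ + |(Real.sqrt N)⁻¹ * ∑ i, boolSign (σ i)| * polarNorm V m := by
        intro ω
        have h3 : (Real.sqrt N)⁻¹ • ∑ i, boolSign (σ i) • U i ω
            = (Real.sqrt N)⁻¹ • ∑ i, boolSign (σ i) • (ξs i ω • Xs i ω)
              + -(((Real.sqrt N)⁻¹ * ∑ i, boolSign (σ i)) • m) := by
          simp only [hU, smul_sub, Finset.sum_sub_distrib, ← Finset.sum_smul, mul_smul]
          rw [sub_eq_add_neg]
        have h4 := polarNorm_add_le hV
          ((Real.sqrt N)⁻¹ • ∑ i, boolSign (σ i) • (ξs i ω • Xs i ω))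
          (-(((Real.sqrt N)⁻¹ * ∑ i, boolSign (σ i)) • m))
        rw [← h3, polarNorm_neg, polarNorm_smul, polarNorm_smul _ m,
          abs_of_nonneg (by positivity : 0 ≤ (Real.sqrt N)⁻¹)] at h4
        exact h4
      have hsU : Integrable (fun ω => polarNorm V (∑ i, boolSign (σ i) • U i ω)) P :=
        integrable_polarNorm hV
          (integrable_finsetSum _ fun i _ => (hUint i).smul (boolSign (σ i)))
      calc ∫ ω, (Real.sqrt N)⁻¹ * polarNorm V (∑ i, U i ω) ∂P
          = (Real.sqrt N)⁻¹ * ∫ ω, polarNorm V (∑ i, U i ω) ∂P := integral_const_mul _ _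
        _ ≤ (Real.sqrt N)⁻¹ * (2 * ∫ ω, polarNorm V (∑ i, boolSign (σ i) • U i ω) ∂P) := by gcongr
        _ = 2 * ∫ ω, (Real.sqrt N)⁻¹ * polarNorm V (∑ i, boolSign (σ i) • U i ω) ∂P := by
            rw [integral_const_mul]; ring
        _ ≤ 2 * ∫ ω, (F ω σ + |(Real.sqrt N)⁻¹ * ∑ i, boolSign (σ i)| * polarNorm V m) ∂P := by
            gcongr ?_ * ?_
            exact integral_mono (hsU.const_mul _) ((hFint σ).add (integrable_const _)) h2
        _ = _ := by
            rw [integral_add (hFint σ) (integrable_const _)]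
            simp
    have havg := signAvg_mono hsigned
    rw [signAvg_const, signAvg_const_mul, signAvg_add] at havg
    have hcomm : signAvg (fun σ : Fin N → Bool => |(Real.sqrt N)⁻¹ * ∑ i, boolSign (σ i)| * polarNorm V m)
        ≤ 7 * (K * s * ν) := by
      simp only [mul_comm _ (polarNorm V m), signAvg_const_mul]
      rw [mul_comm]
      have h1 := signAvg_abs_sum_le hN
      have h2 : 0 ≤ polarNorm V m := polarNorm_nonneg _
      gcongr
    have hFavg : signAvg (fun σ => ∫ ω, F ω σ ∂P) ≤ c * (K * s * ν) := by
      have h1 : signAvg (fun σ => ∫ ω, F ω σ ∂P) = ∫ ω, signAvg (F ω) ∂P := by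
        simp only [signAvg]
        rw [integral_const_mul, integral_finsetSum _ fun σ _ => hFint σ]
      have hFm : AEStronglyMeasurable (fun ω => signAvg (F ω)) P :=
        ((integrable_finsetSum _ fun σ _ => hFint σ).const_mul _).aestronglyMeasurable
      rw [h1, integral_eq_lintegral_of_nonneg_ae
        (Filter.Eventually.of_forall fun ω => signAvg_nonneg (hF0 ω)) hFm]
      refine ENNReal.toReal_le_of_le_ofReal (by positivity) ?_
      refine hproc n K V hK1 hK P N hN Xs ξs (fun i => (hid i).aemeasurable_fst) hind s hs
        (fun i => ?_) fun i j t ht1 ht => ?_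
      · have := (hid i).comp measurable_snd
        exact (this.eLpNorm_eq _).trans_le hξs
      · have := (hid i).comp (u := fun z : EuclideanSpace ℝ (Fin n) × ℝ => z.1 j) (by fun_prop)
        exact (this.eLpNorm_eq _).trans_le (hXmom j t ht1 ht)
    calc _ ≤ _ := havg
      _ ≤ 2 * (c * (K * s * ν) + 7 * (K * s * ν)) := by gcongr
      _ = _ := by ring
  -- let `s` decrease to the `L_q` norm of `ξ`, which may vanish
  have hbound := hgauss n K V hK1 hV hK
  set τ := (eLpNorm ξ (ENNReal.ofReal q) P₀).toReal with hτ
  have hτ0 : 0 ≤ τ := ENNReal.toReal_nonneg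
  have hlim : ∫ ω, (Real.sqrt N)⁻¹ * polarNorm V (∑ i, U i ω) ∂P ≤ 2 * (c + 7) * K * ν * τ := by
    refine le_of_forall_pos_le_add fun ε hε => ?_
    set b := 2 * (c + 7) * K * ν with hb
    have hb0 : 0 ≤ b := by positivity
    have h1 := hmain (τ + ε / (b + 1)) (by positivity) (by
      rw [← ENNReal.ofReal_toReal hξ.eLpNorm_ne_top]
      exact ENNReal.ofReal_le_ofReal (le_add_of_nonneg_right (by positivity)))
    refine h1.trans ?_
    have h2 : b * (ε / (b + 1)) ≤ ε := by
      rw [mul_div_assoc', div_le_iff₀ (by positivity)]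
      nlinarith
    linarith
  calc _ ≤ 2 * (c + 7) * K * ν * τ := hlim
    _ ≤ 2 * (c + 7) * K * (c' * K ^ 2 * ellStar V) * τ := by gcongr
    _ = _ := by ring
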